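/- A real function $k$ on $(0,\infty)$ is called completely monotonic if it is infinitely differentiable and $(-1)^n k^{(n)}(x)\ge 0$ for all $n\ge 0$ and $x>0$. A Bernstein function is a non-negative continuous function $g$ on $[0,\infty)$ that has a derivative on $(0,\infty)$ which is completely monotonic and integrable over $(0,1]$. A complete Bernstein function is a real function $f$ on $[0,\infty)$ for which there is a Bernstein function $g$ such that $$f(x)=x^2\int_0^\infty e^{-xt}\,g(t)\,\mathrm{d}t\quad\text{for all } x>0,\qquad f(0)=\lim_{x\to 0+}f(x).$$ If $f$ and $g$ are complete Bernstein functions and $0\le\alpha\le 1$, then the pointwise product $h(x):=f(x)^{\alpha}\,g(x)^{1-\alpha}$, $x\ge 0$ (with the convention $0^0=1$), is again a complete Bernstein function. -/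

import Mathlib

open Set MeasureTheory

open scoped ContDiff

/-- A real function on `]0, ∞[` is completely monotonic (CM) if it is infinitely differentiable
there and `(-1) ^ n * f⁽ⁿ⁾ ≥ 0` on `]0, ∞[` for every `n ≥ 0`. -/
def IsCompletelyMonotonic (f : ℝ → ℝ) : Prop :=
  ContDiffOn ℝ ∞ f (Ioi 0) ∧
    ∀ n : ℕ, ∀ x ∈ Ioi (0 : ℝ), 0 ≤ (-1) ^ n * iteratedDerivWithin n f (Ioi 0) x

/-- A CM function is locally integrable (LICM) if it is integrable near `0`, equivalently over
the unit interval. -/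
def IsLICM (f : ℝ → ℝ) : Prop :=
  IsCompletelyMonotonic f ∧ IntegrableOn f (Ioc 0 1)

/-- A Bernstein function on `[0, ∞[`: it is non-negative, continuous on `[0, ∞[`, and on
`]0, ∞[` it has a derivative, which is a LICM function. The values of `f` at negative
arguments are irrelevant. -/
def IsBernstein (f : ℝ → ℝ) : Prop :=
  (∀ x ∈ Ici (0 : ℝ), 0 ≤ f x) ∧ ContinuousOn f (Ici 0) ∧
    ∃ k : ℝ → ℝ, IsLICM k ∧ ∀ x ∈ Ioi (0 : ℝ), HasDerivAt f (k x) x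

/-- The (real, one-sided) Laplace transform `∫₀^∞ exp (-p t) g(t) dt`. For a Bernstein function
`g`, which grows at most linearly, the integral converges for every `p > 0`. -/
noncomputable def laplaceTransform (g : ℝ → ℝ) (p : ℝ) : ℝ :=
  ∫ t in Ioi (0 : ℝ), Real.exp (-p * t) * g t

/-- A complete Bernstein function (CBF) on `[0, ∞[`: there is a Bernstein function `g` with
`f(x) = x ^ 2 * (Laplace transform of g)(x)`. The Laplace integral is only meaningful for
`x > 0`; at `x = 0` the right-hand side stands for its limit as `x → 0+`, so that `f` is
continuous at `0`. The values of `f` at negative arguments are irrelevant. -/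
def IsCompleteBernstein (f : ℝ → ℝ) : Prop :=
  ContinuousWithinAt f (Ici 0) 0 ∧
    ∃ g : ℝ → ℝ, IsBernstein g ∧ ∀ x ∈ Ioi (0 : ℝ), f x = x ^ 2 * laplaceTransform g x

/-! On the half-line `x > 0`, complete Bernstein functions form the closed convex cone generated
pointwise by the functions `x / (x + t)`, and this cone is stable under `F ↦ x / F`. Means and
inversions already give geometric means. Heron's iteration for `√(F G)` keeps both `a n` and `F G /
a n` in the cone, because the next quotient is the harmonic mean of these two. So the exponents `α`
for which `F ^ α * G ^ (1 - α)` lies in the cone form a closed, midpoint-stable set containing `0`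
and `1`. Stability under inversion is finite-dimensional linear algebra
(`exists_inv_sum_sq_div_eq`), passed to the closure by `div_mem_stieltjesCone`. To enter the cone,
the Laplace transform is approximated with powers of `(1 + x h)⁻¹` in place of exponentials. Abel
summation leaves the increments of the Bernstein function, a completely monotone sequence, and the
Bernstein-polynomial solution of Hausdorff's moment problem turns its generating function into a
limit of atoms (`IsCompleteBernstein.mem_stieltjesCone`). To leave it, weak compactness of bounded
measures on `[0, 1]` represents each element by an integral, and integrating elementary Bernstein
functions against that measure gives the required one (`isCompleteBernstein_of_mem_stieltjesCone`).
-/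

open Filter Topology ProbabilityTheory
open scoped NNReal

/-! ### Reciprocals of finite Stieltjes sums -/

open scoped InnerProductSpace in
/-- The reciprocal of a finite Stieltjes sum, expressed through the compression of the diagonal
operator with entries `t i` to the orthogonal complement of `v`. -/
theorem exists_inv_sum_sq_div_eq {ι : Type*} [Fintype ι] (t v : ι → ℝ) (ht : ∀ i, 0 < t i)
    (hv : v ≠ 0) :
    ∃ (m : ℕ) (n β : ℝ) (c l : Fin m → ℝ), 0 < n ∧ 0 ≤ β ∧ (∀ j, 0 ≤ c j) ∧ (∀ j, 0 < l j) ∧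
      ∀ x : ℝ, 0 < x →
        (∑ i, v i ^ 2 / (x + t i))⁻¹ = n * (x + β + ∑ j, c j * (x / (x + l j))) := by
  classical
  let V : EuclideanSpace ℝ ι := WithLp.toLp 2 v
  let D : EuclideanSpace ℝ ι →ₗ[ℝ] EuclideanSpace ℝ ι := Matrix.toEuclideanLin (Matrix.diagonal t)
  have hD : ∀ (w : EuclideanSpace ℝ ι) i, D w i = t i * w i := by
    intro w i
    simp [D, Matrix.toLpLin_apply, Matrix.mulVec_diagonal]
  have inner_eq : ∀ a b : EuclideanSpace ℝ ι, ⟪a, b⟫_ℝ = ∑ i, a i * b i := by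
    intro a b
    simp [PiLp.inner_apply, mul_comm]
  have hDs : ∀ a b : EuclideanSpace ℝ ι, ⟪D a, b⟫_ℝ = ⟪a, D b⟫_ℝ := by
    intro a b
    simp only [inner_eq, hD]
    exact Finset.sum_congr rfl fun i _ => by ring
  have hV0 : V ≠ 0 := by
    intro h
    exact hv (by ext i; simpa [V] using congrArg (fun w : EuclideanSpace ℝ ι => w i) h)
  set N : ℝ := ⟪V, V⟫_ℝ with hN
  have hNpos : 0 < N := real_inner_self_pos.2 hV0
  let W : Submodule ℝ (EuclideanSpace ℝ ι) := (ℝ ∙ V)ᗮ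
  have hWmem : ∀ w : EuclideanSpace ℝ ι, w ∈ W ↔ ⟪V, w⟫_ℝ = 0 := fun w => Submodule.mem_orthogonal_singleton_iff_inner_right
  -- The sum is `⟪V, (x + D)⁻¹ V⟫`, so its reciprocal is, up to scale, the Schur complement of `x +
  -- D` on the line of `V`; diagonalising the compression `A` makes it explicit.
  let A : W →ₗ[ℝ] W := (W.orthogonalProjectionOnto : EuclideanSpace ℝ ι →ₗ[ℝ] W) ∘ₗ D ∘ₗ W.subtype
  have hA1 : ∀ a b : W, ⟪A a, b⟫_ℝ = ⟪D a, (b : EuclideanSpace ℝ ι)⟫_ℝ := by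
    intro a b
    exact Submodule.inner_orthogonalProjectionOnto_eq_of_mem_right b _
  have hA : A.IsSymmetric := by
    intro a b
    rw [hA1, hDs, real_inner_comm, ← hA1, real_inner_comm]
  obtain ⟨m, hm⟩ : ∃ m, Module.finrank ℝ W = m := ⟨_, rfl⟩
  let e := hA.eigenvectorBasis hm
  let l := hA.eigenvalues hm
  have hl : ∀ j, 0 < l j := by
    intro j
    have h1 : l j = ⟪D (e j), (e j : EuclideanSpace ℝ ι)⟫_ℝ := by
      rw [← hA1, hA.apply_eigenvectorBasis hm j]
      simp only [RCLike.ofReal_real_eq_id, id_eq, real_inner_smul_left]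
      simp [l, e]
    have h2 : (e j : EuclideanSpace ℝ ι) ≠ 0 := by
      simpa using e.orthonormal.ne_zero j
    rw [h1, inner_eq]
    obtain ⟨i, hi⟩ : ∃ i, (e j : EuclideanSpace ℝ ι) i ≠ 0 := by
      by_contra! h
      exact h2 (by ext i; simpa using h i)
    refine Finset.sum_pos' (fun i _ => ?_) ⟨i, Finset.mem_univ _, ?_⟩
    · rw [hD, mul_assoc]
      exact mul_nonneg (ht i).le (mul_self_nonneg _)
    · rw [hD, mul_assoc]
      exact mul_pos (ht i) (mul_self_pos.2 hi)
  let d : Fin m → ℝ := fun j => ⟪(e j : EuclideanSpace ℝ ι), D V⟫_ℝ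
  set B : ℝ := ⟪D V, V⟫_ℝ with hB
  -- The case `x = 0` is included because it yields the sign of `β`.
  have key : ∀ x : ℝ, 0 ≤ x → 0 < ∑ i, v i ^ 2 / (x + t i) ∧
      (∑ i, v i ^ 2 / (x + t i)) * (x + (B - ∑ j, d j ^ 2 / (x + l j)) / N) = N := by
    intro x hx
    have hxt : ∀ i, 0 < x + t i := fun i => add_pos_of_nonneg_of_pos hx (ht i)
    have hxl : ∀ i, 0 < x + l i := fun i => add_pos_of_nonneg_of_pos hx (hl i)
    set S := ∑ i, v i ^ 2 / (x + t i) with hS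
    have hSpos : 0 < S := by
      obtain ⟨i, hi⟩ : ∃ i, v i ≠ 0 := by
        by_contra! h
        exact hv (funext h)
      refine Finset.sum_pos' (fun i _ => div_nonneg (sq_nonneg _) (hxt i).le)
        ⟨i, Finset.mem_univ _, div_pos (by positivity) (hxt i)⟩
    refine ⟨hSpos, ?_⟩
    let u : EuclideanSpace ℝ ι := WithLp.toLp 2 fun i => v i / (x + t i)
    have hu : x • u + D u = V := by
      ext i
      have := (hxt i).ne'
      simp only [PiLp.add_apply, PiLp.smul_apply, hD, smul_eq_mul, u, V]
      field_simp
    have hVu : ⟪V, u⟫_ℝ = S := by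
      rw [inner_eq, hS]
      exact Finset.sum_congr rfl fun i _ => by simp only [V, u]; ring
    have hw : u - (S / N) • V ∈ W := by
      rw [hWmem, inner_sub_right, real_inner_smul_right, hVu, ← hN]
      field_simp
      ring
    let w : W := ⟨u - (S / N) • V, hw⟩
    have huw : u = (S / N) • V + (w : EuclideanSpace ℝ ι) := by simp [w]
    have hVe : ∀ j, ⟪(e j : EuclideanSpace ℝ ι), V⟫_ℝ = 0 := by
      intro j
      rw [real_inner_comm]
      exact (hWmem _).1 (e j).2
    -- Pair `(x + D) u = V` with the eigenvector `e j`, which is orthogonal to `V`.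
    have ha : ∀ j, ⟪e j, w⟫_ℝ = -(S / N) * d j / (x + l j) := by
      intro j
      have h1 : ⟪(e j : EuclideanSpace ℝ ι), x • u + D u⟫_ℝ = 0 := by rw [hu, hVe]
      have h2 : ⟪(e j : EuclideanSpace ℝ ι), D w⟫_ℝ = l j * ⟪e j, w⟫_ℝ := by
        rw [← hDs, ← hA1, hA.apply_eigenvectorBasis hm j]
        simp only [RCLike.ofReal_real_eq_id, id_eq, real_inner_smul_left]
        rfl
      have h3 : ⟪(e j : EuclideanSpace ℝ ι), (w : EuclideanSpace ℝ ι)⟫_ℝ = ⟪e j, w⟫_ℝ := rfl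
      rw [huw] at h1
      simp only [map_add, map_smul, inner_add_right, real_inner_smul_right, hVe, h2, h3] at h1
      rw [eq_div_iff (hxl j).ne']
      change _ = -(S / N) * ⟪(e j : EuclideanSpace ℝ ι), D V⟫_ℝ
      linarith
    have hsum : ⟪D V, (w : EuclideanSpace ℝ ι)⟫_ℝ = ∑ j, d j * ⟪e j, w⟫_ℝ := by
      have h1 : ⟪D V, (w : EuclideanSpace ℝ ι)⟫_ℝ = ⟪W.orthogonalProjectionOnto (D V), w⟫_ℝ := by
        exact (Submodule.inner_orthogonalProjectionOnto_eq_of_mem_right w _).symm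
      rw [h1, ← e.sum_inner_mul_inner]
      refine Finset.sum_congr rfl fun j _ => ?_
      congr 1
      rw [Submodule.inner_orthogonalProjectionOnto_eq_of_mem_right, real_inner_comm]
    have h4 : ⟪V, x • u + D u⟫_ℝ = N := by rw [hu]
    rw [inner_add_right, real_inner_smul_right, hVu, ← hDs, huw, inner_add_right,
      real_inner_smul_right, ← hB, hsum] at h4
    have h5 : ∑ j, d j * ⟪e j, w⟫_ℝ = -(S / N) * ∑ j, d j ^ 2 / (x + l j) := by
      rw [Finset.mul_sum]
      refine Finset.sum_congr rfl fun j _ => ?_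
      rw [ha]
      ring
    rw [h5] at h4
    linear_combination h4
  -- The constants come from `d² / l - d² / (x + l) = (d² / l) * (x / (x + l))`.
  refine ⟨m, N⁻¹, (B - ∑ j, d j ^ 2 / l j) / N, fun j => d j ^ 2 / l j / N, l, inv_pos.2 hNpos,
    ?_, fun j => div_nonneg (div_nonneg (sq_nonneg _) (hl j).le) hNpos.le, hl, ?_⟩
  · obtain ⟨h1, h2⟩ := key 0 le_rfl
    simp only [zero_add] at h1 h2
    by_contra! h
    nlinarith
  · intro x hx
    obtain ⟨h1, h2⟩ := key x hx.le
    have h3 : ∑ j, d j ^ 2 / l j / N * (x / (x + l j))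
        = (∑ j, d j ^ 2 / l j - ∑ j, d j ^ 2 / (x + l j)) / N := by
      rw [← Finset.sum_sub_distrib, Finset.sum_div]
      refine Finset.sum_congr rfl fun j _ => ?_
      have := hl j
      have : x + l j ≠ 0 := by positivity
      field_simp
      ring
    rw [h3, inv_eq_iff_eq_inv, eq_comm, inv_eq_iff_eq_inv]
    field_simp at h2 ⊢
    linarith

/-! ### The cone and its stability under inversion -/

/-- The function `x ↦ x / (x + t)` on the positive half-line. -/
noncomputable def stieltjesAtom (t : ℝ) : Ioi (0 : ℝ) → ℝ := fun x => x / (x + t)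

/-- The cone of pointwise limits of finite non-negative combinations of the functions
`x ↦ x / (x + t)`, `t > 0`, on the positive half-line. -/
noncomputable def stieltjesCone : Submodule ℝ≥0 (Ioi (0 : ℝ) → ℝ) :=
  (Submodule.span ℝ≥0 (stieltjesAtom '' Ioi 0)).topologicalClosure

theorem isClosed_stieltjesCone : IsClosed (stieltjesCone : Set (Ioi (0 : ℝ) → ℝ)) :=
  Submodule.isClosed_topologicalClosure _

theorem stieltjesAtom_mem_of_pos {t : ℝ} (ht : 0 < t) : stieltjesAtom t ∈ stieltjesCone :=
  Submodule.le_topologicalClosure _ (Submodule.subset_span ⟨t, ht, rfl⟩)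

theorem smul_mem_stieltjesCone {F : Ioi (0 : ℝ) → ℝ} (hF : F ∈ stieltjesCone) {c : ℝ}
    (hc : 0 ≤ c) : (fun x => c * F x) ∈ stieltjesCone :=
  stieltjesCone.smul_mem (⟨c, hc⟩ : ℝ≥0) hF

/-- This is the limit of the atoms as `t → 0`; the next lemma is the limit of `t` times the atom as
`t → ∞`. These are the two endpoints of the family. -/
theorem one_mem_stieltjesCone : (fun _ => 1 : Ioi (0 : ℝ) → ℝ) ∈ stieltjesCone := by
  refine isClosed_stieltjesCone.mem_of_tendsto (f := fun n : ℕ => stieltjesAtom (1 / (n + 1)))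
    (b := atTop) ?_ (Eventually.of_forall fun n => stieltjesAtom_mem_of_pos (by positivity))
  rw [tendsto_pi_nhds]
  intro x
  have hx : (x : ℝ) ≠ 0 := ne_of_gt x.2
  have h := (tendsto_const_nhds (x := (x : ℝ)) (f := atTop)).div
    ((tendsto_const_nhds (x := (x : ℝ))).add tendsto_one_div_add_atTop_nhds_zero_nat)
    (by simpa using hx)
  simp only [add_zero, div_self hx] at h
  exact h

theorem coe_mem_stieltjesCone : (fun x : Ioi (0 : ℝ) => (x : ℝ)) ∈ stieltjesCone := by
  refine isClosed_stieltjesCone.mem_of_tendsto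
    (f := fun (n : ℕ) (x : Ioi (0 : ℝ)) => ((n : ℝ) + 1) * stieltjesAtom (n + 1) x)
    (b := atTop) ?_ (Eventually.of_forall fun n =>
      smul_mem_stieltjesCone (stieltjesAtom_mem_of_pos (by positivity)) (by positivity))
  rw [tendsto_pi_nhds]
  intro x
  have hx : (0 : ℝ) < x := x.2
  have h := (tendsto_const_nhds (x := (x : ℝ)) (f := atTop)).div
    ((tendsto_one_div_add_atTop_nhds_zero_nat.const_mul (x : ℝ)).add_const 1)
    (by simp)
  simp only [mul_zero, zero_add, div_one] at h
  refine h.congr fun n => ?_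
  have : (x : ℝ) + (n + 1) ≠ 0 := by positivity
  simp only [stieltjesAtom, Pi.div_apply]
  field_simp

theorem stieltjesAtom_mem {t : ℝ} (ht : 0 ≤ t) : stieltjesAtom t ∈ stieltjesCone := by
  rcases ht.eq_or_lt with rfl | ht
  · convert! one_mem_stieltjesCone using 1
    ext x
    have hx : (x : ℝ) ≠ 0 := ne_of_gt x.2
    simp [stieltjesAtom, hx]
  · exact stieltjesAtom_mem_of_pos ht

/-- The bounds between which a function of the cone lies are controlled by its value at `1`. -/
theorem bounds_of_mem_stieltjesCone {F : Ioi (0 : ℝ) → ℝ} (hF : F ∈ stieltjesCone)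
    (x : Ioi (0 : ℝ)) :
    min 1 (x : ℝ) * F ⟨1, mem_Ioi.2 one_pos⟩ ≤ F x ∧ F x ≤ max 1 (x : ℝ) * F ⟨1, mem_Ioi.2 one_pos⟩ := by
  -- Both inequalities are closed and stable under non-negative combinations, so only atoms need
  -- checking.
  have hcl : IsClosed
      ({F : Ioi (0 : ℝ) → ℝ | min 1 (x : ℝ) * F ⟨1, mem_Ioi.2 one_pos⟩ ≤ F x} ∩
        {F : Ioi (0 : ℝ) → ℝ | F x ≤ max 1 (x : ℝ) * F ⟨1, mem_Ioi.2 one_pos⟩}) :=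
    (isClosed_le (by fun_prop) (by fun_prop)).inter (isClosed_le (by fun_prop) (by fun_prop))
  refine closure_minimal ?_ hcl hF
  intro G hG
  have hx : (0 : ℝ) < x := x.2
  induction hG using Submodule.span_induction with
  | mem G h =>
    obtain ⟨t, ht, rfl⟩ := h
    have ht : 0 < t := ht
    simp only [stieltjesAtom, mem_inter_iff, mem_ofPred_eq]
    constructor
    · rw [mul_one_div, div_le_div_iff₀ (by positivity) (by positivity)]
      rcases le_total 1 (x : ℝ) with h | h
      · rw [min_eq_left h]; nlinarith
      · rw [min_eq_right h]; nlinarith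
    · rw [mul_one_div, div_le_div_iff₀ (by positivity) (by positivity)]
      rcases le_total 1 (x : ℝ) with h | h
      · rw [max_eq_right h]; nlinarith
      · rw [max_eq_left h]; nlinarith
  | zero => simp
  | add G H _ _ h1 h2 =>
    simp only [mem_inter_iff, mem_ofPred_eq, Pi.add_apply, mul_add] at *
    exact ⟨add_le_add h1.1 h2.1, add_le_add h1.2 h2.2⟩
  | smul c G _ h =>
    have hc : (0 : ℝ) ≤ c := c.2
    simp only [mem_inter_iff, mem_ofPred_eq, Pi.smul_apply, NNReal.smul_def, smul_eq_mul] at *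
    constructor
    · nlinarith [mul_le_mul_of_nonneg_left h.1 hc]
    · nlinarith [mul_le_mul_of_nonneg_left h.2 hc]

theorem pos_of_mem_stieltjesCone {F : Ioi (0 : ℝ) → ℝ} (hF : F ∈ stieltjesCone)
    (h1 : 0 < F ⟨1, mem_Ioi.2 one_pos⟩) (x : Ioi (0 : ℝ)) : 0 < F x :=
  lt_of_lt_of_le (mul_pos (lt_min one_pos x.2) h1) (bounds_of_mem_stieltjesCone hF x).1

/-- The map `F ↦ x / F` sends the finite combinations of atoms into the cone. -/
theorem div_mem_stieltjesCone_of_mem_span {F : Ioi (0 : ℝ) → ℝ}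
    (hF : F ∈ Submodule.span ℝ≥0 (stieltjesAtom '' Ioi 0)) (h1 : 0 < F ⟨1, mem_Ioi.2 one_pos⟩) :
    (fun x : Ioi (0 : ℝ) => (x : ℝ) / F x) ∈ stieltjesCone := by
  obtain ⟨k, c, g, hF'⟩ := (Submodule.mem_span_set' (R := ℝ≥0)).1 hF
  choose t ht htg using fun i => (g i).2
  have hFx : ∀ x : Ioi (0 : ℝ), F x = x * ∑ i, Real.sqrt (c i) ^ 2 / (x + t i) := by
    intro x
    rw [← hF', Finset.sum_apply, Finset.mul_sum]
    refine Finset.sum_congr rfl fun i _ => ?_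
    rw [← htg i, Real.sq_sqrt (NNReal.coe_nonneg _), Pi.smul_apply, NNReal.smul_def, stieltjesAtom, smul_eq_mul]
    ring
  have hv : (fun i => Real.sqrt (c i)) ≠ 0 := by
    intro h
    rw [hFx] at h1
    simp only [funext_iff, Pi.zero_apply] at h
    simp [h] at h1
  obtain ⟨m, n, β, d, l, hn, hβ, hd, hl, H⟩ := exists_inv_sum_sq_div_eq t _ ht hv
  have hmem : ((fun x : Ioi (0 : ℝ) => (x : ℝ)) + ((fun x => β * (fun _ => 1 : Ioi (0 : ℝ) → ℝ) x) +
      ∑ j, fun x => d j * stieltjesAtom (l j) x)) ∈ stieltjesCone :=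
    add_mem coe_mem_stieltjesCone (add_mem (smul_mem_stieltjesCone one_mem_stieltjesCone hβ)
      (sum_mem fun j _ => smul_mem_stieltjesCone (stieltjesAtom_mem_of_pos (hl j)) (hd j)))
  convert! smul_mem_stieltjesCone hmem hn.le using 1
  ext x
  have hx : (0 : ℝ) < x := x.2
  have h2 := H x hx
  rw [hFx, ← div_div, div_self hx.ne', one_div, h2]
  simp only [Pi.add_apply, Finset.sum_apply, stieltjesAtom]
  ring

/-- Positivity at `1` is an open condition, so `F` is a limit of finite combinations satisfying it;
since `F` is then positive everywhere, inversion is continuous at `F`. -/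
theorem div_mem_stieltjesCone {F : Ioi (0 : ℝ) → ℝ} (hF : F ∈ stieltjesCone)
    (h1 : 0 < F ⟨1, mem_Ioi.2 one_pos⟩) : (fun x : Ioi (0 : ℝ) => (x : ℝ) / F x) ∈ stieltjesCone := by
  have hopen : IsOpen {F : Ioi (0 : ℝ) → ℝ | 0 < F ⟨1, mem_Ioi.2 one_pos⟩} :=
    isOpen_lt continuous_const (continuous_apply _)
  have hmem : F ∈ closure ({F : Ioi (0 : ℝ) → ℝ | 0 < F ⟨1, mem_Ioi.2 one_pos⟩} ∩
      (Submodule.span ℝ≥0 (stieltjesAtom '' Ioi 0) : Set (Ioi (0 : ℝ) → ℝ))) :=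
    hopen.inter_closure ⟨h1, hF⟩
  have hcont : ContinuousAt (fun (G : Ioi (0 : ℝ) → ℝ) (x : Ioi (0 : ℝ)) => (x : ℝ) / G x) F := by
    rw [continuousAt_pi]
    intro x
    exact continuousAt_const.div (continuous_apply x).continuousAt
      (pos_of_mem_stieltjesCone hF h1 x).ne'
  have := hcont.continuousWithinAt.mem_closure hmem
    (t := (stieltjesCone : Set (Ioi (0 : ℝ) → ℝ)))
    fun G hG => div_mem_stieltjesCone_of_mem_span hG.2 hG.1
  rwa [isClosed_stieltjesCone.closure_eq] at this

/-! ### Geometric means -/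

/-- Heron's iteration for the square root. -/
theorem tendsto_heron {p : ℝ} (hp : 0 < p) (u : ℕ → ℝ) (h0 : 0 < u 0)
    (hu : ∀ n, u (n + 1) = 2⁻¹ * (u n + p / u n)) : Tendsto u atTop (𝓝 √p) := by
  have hpos : ∀ n, 0 < u n := by
    intro n
    induction n with
    | zero => exact h0
    | succ n ih => rw [hu]; positivity
  have hr : √p ^ 2 = p := Real.sq_sqrt hp.le
  have hr0 : 0 < √p := Real.sqrt_pos.2 hp
  have hstep : ∀ n, u (n + 1) - √p = (u n - √p) ^ 2 / (2 * u n) := by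
    intro n
    have := (hpos n).ne'
    rw [hu]
    field_simp
    linear_combination -hr
  have hge : ∀ n, 0 ≤ u (n + 1) - √p := fun n => by
    rw [hstep]
    have := hpos n
    positivity
  have hle : ∀ n, u (n + 1) - √p ≤ (u 1 - √p) * (1 / 2) ^ n := by
    intro n
    induction n with
    | zero => simp
    | succ n ih =>
      rw [pow_succ, ← mul_assoc]
      have h1 := hge n
      have h2 := hpos (n + 1)
      refine le_trans ?_ (mul_le_mul_of_nonneg_right ih (by norm_num))
      rw [hstep, div_le_iff₀ (by positivity)]
      nlinarith
  have hlim : Tendsto (fun n => u (n + 1) - √p) atTop (𝓝 0) := by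
    refine squeeze_zero hge hle ?_
    simpa using (tendsto_pow_atTop_nhds_zero_of_lt_one (by norm_num : (0 : ℝ) ≤ 1 / 2)
      (by norm_num)).const_mul (u 1 - √p)
  rw [← tendsto_add_atTop_iff_nat 1]
  simpa using hlim.add_const √p

/-- The cone is not closed under products, so membership of `F G / a n` is carried along with that
of `a n`. With `A = a n` and `B = F G / a n`, the next quotient is `2 A B / (A + B)`, that is, `x`
divided by the mean of `x / A` and `x / B`. -/
theorem sqrt_mul_mem_stieltjesCone {F G : Ioi (0 : ℝ) → ℝ} (hF : F ∈ stieltjesCone)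
    (hG : G ∈ stieltjesCone) (hF1 : 0 < F ⟨1, mem_Ioi.2 one_pos⟩) (hG1 : 0 < G ⟨1, mem_Ioi.2 one_pos⟩) :
    (fun x => √(F x * G x)) ∈ stieltjesCone := by
  have hFp := pos_of_mem_stieltjesCone hF hF1
  have hGp := pos_of_mem_stieltjesCone hG hG1
  let a : ℕ → Ioi (0 : ℝ) → ℝ := fun n =>
    Nat.rec F (fun _ u x => 2⁻¹ * (u x + F x * G x / u x)) n
  have ha : ∀ n x, a (n + 1) x = 2⁻¹ * (a n x + F x * G x / a n x) := fun n x => rfl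
  have hmean : ∀ {A B : Ioi (0 : ℝ) → ℝ}, A ∈ stieltjesCone → B ∈ stieltjesCone →
      (fun x => 2⁻¹ * (A x + B x)) ∈ stieltjesCone := fun hA hB =>
    smul_mem_stieltjesCone (add_mem hA hB) (by norm_num)
  have hmem : ∀ n, a n ∈ stieltjesCone ∧ (fun x => F x * G x / a n x) ∈ stieltjesCone ∧
      ∀ x, 0 < a n x := by
    intro n
    induction n with
    | zero =>
      refine ⟨hF, ?_, hFp⟩
      convert! hG using 1
      ext x
      exact mul_div_cancel_left₀ _ (hFp x).ne'
    | succ n ih =>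
      obtain ⟨h1, h2, h3⟩ := ih
      have h4 : ∀ x, 0 < F x * G x / a n x := fun x => div_pos (mul_pos (hFp x) (hGp x)) (h3 x)
      refine ⟨hmean h1 h2, ?_, fun x => ?_⟩
      · have h5 := hmean (div_mem_stieltjesCone h1 (h3 _)) (div_mem_stieltjesCone h2 (h4 _))
        have h6 := div_mem_stieltjesCone h5 (mul_pos (by norm_num) (add_pos
          (div_pos one_pos (h3 _)) (div_pos one_pos (h4 _))))
        convert! h6 using 1
        ext x
        have hx : (0 : ℝ) < x := x.2
        have := h3 x
        have := hFp x
        have := hGp x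
        rw [ha]
        field_simp
        ring
      · rw [ha]
        exact mul_pos (by norm_num) (add_pos (h3 x) (h4 x))
  refine isClosed_stieltjesCone.mem_of_tendsto (f := a) (b := atTop) ?_
    (Eventually.of_forall fun n => (hmem n).1)
  rw [tendsto_pi_nhds]
  exact fun x => tendsto_heron (mul_pos (hFp x) (hGp x)) _ (hFp x) (fun n => ha n x)

/-- A closed set of reals that contains `0` and `1` and is closed under midpoints contains the
unit interval. -/
theorem Icc_subset_of_isClosed_of_midpoint {A : Set ℝ} (hA : IsClosed A) (h0 : 0 ∈ A)
    (h1 : 1 ∈ A) (hmid : ∀ a ∈ A, ∀ b ∈ A, (a + b) / 2 ∈ A) : Icc 0 1 ⊆ A := by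
  intro x hx
  obtain ⟨a, ⟨haA, ha⟩, ha'⟩ := (isCompact_Icc.inter_left hA).exists_isGreatest
    (⟨0, h0, le_rfl, hx.1⟩ : (A ∩ Icc 0 x).Nonempty)
  obtain ⟨b, ⟨hbA, hb⟩, hb'⟩ := (isCompact_Icc.inter_left hA).exists_isLeast
    (⟨1, h1, hx.2, le_rfl⟩ : (A ∩ Icc x 1).Nonempty)
  have hm := hmid a haA b hbA
  rcases le_total ((a + b) / 2) x with h | h
  · have h2 : (a + b) / 2 ≤ a := ha' ⟨hm, by linarith [ha.1, hb.1, hx.1], h⟩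
    have : x = a := le_antisymm (by linarith [hb.1]) ha.2
    rwa [this]
  · have h2 : b ≤ (a + b) / 2 := hb' ⟨hm, h, by linarith [ha.2, hb.2, hx.2]⟩
    have : x = b := le_antisymm hb.1 (by linarith [ha.2])
    rwa [this]

/-- The cone is closed under weighted geometric means. -/
theorem rpow_mul_rpow_mem_stieltjesCone {F G : Ioi (0 : ℝ) → ℝ} (hF : F ∈ stieltjesCone)
    (hG : G ∈ stieltjesCone) (hF1 : 0 < F ⟨1, mem_Ioi.2 one_pos⟩) (hG1 : 0 < G ⟨1, mem_Ioi.2 one_pos⟩) {α : ℝ}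
    (hα : α ∈ Icc (0 : ℝ) 1) : (fun x => F x ^ α * G x ^ (1 - α)) ∈ stieltjesCone := by
  have hFp := pos_of_mem_stieltjesCone hF hF1
  have hGp := pos_of_mem_stieltjesCone hG hG1
  have hcont : Continuous fun (α : ℝ) (x : Ioi (0 : ℝ)) => F x ^ α * G x ^ (1 - α) := by
    refine continuous_pi fun x => ?_
    exact (Real.continuous_const_rpow (hFp x).ne').mul
      ((Real.continuous_const_rpow (hGp x).ne').comp (continuous_const.sub continuous_id))
  have hpos : ∀ (a : ℝ) x, 0 < F x ^ a * G x ^ (1 - a) := fun a x =>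
    mul_pos (Real.rpow_pos_of_pos (hFp x) _) (Real.rpow_pos_of_pos (hGp x) _)
  -- The geometric mean of the functions for exponents `a` and `b` is the function for `(a + b) /
  -- 2`.
  refine Icc_subset_of_isClosed_of_midpoint (isClosed_stieltjesCone.preimage hcont)
    (by simpa using hG) (by simpa using hF) (fun a ha b hb => ?_) hα
  have h := sqrt_mul_mem_stieltjesCone ha hb (hpos a _) (hpos b _)
  rw [mem_preimage]
  convert! h using 1
  ext x
  rw [eq_comm, Real.sqrt_eq_iff_mul_self_eq (mul_pos (hpos a x) (hpos b x)).le (hpos _ x).le]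
  have e1 : F x ^ ((a + b) / 2) * F x ^ ((a + b) / 2) = F x ^ a * F x ^ b := by
    rw [← Real.rpow_add (hFp x), ← Real.rpow_add (hFp x)]
    ring_nf
  have e2 : G x ^ (1 - (a + b) / 2) * G x ^ (1 - (a + b) / 2)
      = G x ^ (1 - a) * G x ^ (1 - b) := by
    rw [← Real.rpow_add (hGp x), ← Real.rpow_add (hGp x)]
    ring_nf
  calc _ = (F x ^ ((a + b) / 2) * F x ^ ((a + b) / 2)) *
        (G x ^ (1 - (a + b) / 2) * G x ^ (1 - (a + b) / 2)) := by rw [e1, e2]; ring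
    _ = _ := by ring

/-! ### Hausdorff moments and generating functions of completely monotone sequences -/

/-- The weights of the Bernstein polynomials under the moment functional of the sequence `m`. -/
noncomputable def bernsteinWeight (m : ℕ → ℝ) (n ν : ℕ) : ℝ :=
  n.choose ν * ((-1) ^ (n - ν) * (fwdDiff 1)^[n - ν] m ν)

theorem bernsteinWeight_nonneg {m : ℕ → ℝ} (hm : ∀ n j, 0 ≤ (-1) ^ n * (fwdDiff 1)^[n] m j) (n ν : ℕ) :
    0 ≤ bernsteinWeight m n ν :=
  mul_nonneg (Nat.cast_nonneg _) (hm _ _)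

/-- Binomial expansion of the identity as `(E - Δ) ^ N`, with `E` the shift and `Δ` the forward
difference. -/
theorem eq_sum_choose_mul_fwdDiff (m : ℕ → ℝ) (N j : ℕ) :
    m j = ∑ q ∈ Finset.range (N + 1),
      (N.choose q : ℝ) * ((-1) ^ (N - q) * (fwdDiff 1)^[N - q] m (j + q)) := by
  induction N generalizing j with
  | zero => simp
  | succ N ih =>
    have hstep : ∀ q ∈ Finset.range (N + 1), (-1 : ℝ) ^ (N - q) * (fwdDiff 1)^[N - q] m (j + q) =
        (-1) ^ (N + 1 - q) * (fwdDiff 1)^[N + 1 - q] m (j + q) +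
        (-1) ^ (N - q) * (fwdDiff 1)^[N - q] m (j + q + 1) := by
      intro q hq
      have hq' : N + 1 - q = (N - q) + 1 := by
        have := Finset.mem_range.1 hq
        omega
      rw [hq', Function.iterate_succ_apply', fwdDiff, pow_succ]
      ring
    let T : ℕ → ℝ := fun q => (-1) ^ (N + 1 - q) * (fwdDiff 1)^[N + 1 - q] m (j + q)
    have h1 : m j = ∑ q ∈ Finset.range (N + 1), (N.choose q : ℝ) * T q +
        ∑ q ∈ Finset.range (N + 1), (N.choose q : ℝ) * T (q + 1) := by
      rw [← Finset.sum_add_distrib]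
      nth_rewrite 1 [ih j]
      refine Finset.sum_congr rfl fun q hq => ?_
      rw [hstep q hq, mul_add]
      simp [T, add_assoc]
    rw [h1, Finset.sum_range_succ' _ (N + 1), Finset.sum_range_succ' _ N]
    have h2 : ∑ q ∈ Finset.range (N + 1), ((N + 1).choose (q + 1) : ℝ) * T (q + 1) =
        ∑ q ∈ Finset.range (N + 1), (N.choose q : ℝ) * T (q + 1) +
        ∑ q ∈ Finset.range (N + 1), (N.choose (q + 1) : ℝ) * T (q + 1) := by
      rw [← Finset.sum_add_distrib]
      refine Finset.sum_congr rfl fun q _ => ?_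
      rw [Nat.choose_succ_succ]
      push_cast
      ring
    change _ = ∑ q ∈ Finset.range (N + 1), ((N + 1).choose (q + 1) : ℝ) * T (q + 1) +
      ((N + 1).choose 0 : ℝ) * T 0
    rw [h2, Finset.sum_range_succ (fun q => (N.choose (q + 1) : ℝ) * T (q + 1)) N]
    simp
    ring

/-- The previous expansion with `N = n - j`, reindexed by `ν = j + q`; terms with `ν < j` vanish.
The weights thus reproduce `m j` exactly once the power `(ν / n) ^ j` is replaced by a quotient of
binomials. -/
theorem eq_sum_choose_div_mul_bernsteinWeight (m : ℕ → ℝ) {n j : ℕ} (hj : j ≤ n) :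
    m j = ∑ ν ∈ Finset.range (n + 1),
      (ν.choose j : ℝ) / n.choose j * bernsteinWeight m n ν := by
  obtain ⟨N, rfl⟩ := Nat.exists_eq_add_of_le hj
  rw [add_assoc, Finset.sum_range_add, Finset.sum_eq_zero, zero_add, eq_sum_choose_mul_fwdDiff m N j]
  · refine Finset.sum_congr rfl fun q hq => ?_
    have hq' : q ≤ N := Nat.lt_succ_iff.1 (Finset.mem_range.1 hq)
    have h1 := Nat.choose_mul (n := j + N) (k := j + q) (s := j) (by omega)
    have h2 : ((j + N).choose j : ℝ) ≠ 0 := by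
      exact_mod_cast (Nat.choose_pos hj).ne'
    have h3 : ((j + N).choose (j + q) : ℝ) * (j + q).choose j = (j + N).choose j * N.choose q := by
      rw [show j + N - j = N by omega, show j + q - j = q by omega] at h1
      exact_mod_cast h1
    rw [bernsteinWeight, show j + N - (j + q) = N - q by omega, div_mul_eq_mul_div, eq_div_iff h2]
    linear_combination (-((-1) ^ (N - q) * (fwdDiff 1)^[N - q] m (j + q))) * h3
  · intro ν hν
    rw [Nat.choose_eq_zero_of_lt (Finset.mem_range.1 hν)]
    simp

theorem sum_bernsteinWeight (m : ℕ → ℝ) (n : ℕ) :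
    ∑ ν ∈ Finset.range (n + 1), bernsteinWeight m n ν = m 0 := by
  rw [eq_sum_choose_div_mul_bernsteinWeight m (Nat.zero_le n)]
  simp

/-- The quotient is the product of `(ν - i) / (n - i)` for `i < j`, and each factor is close to `ν /
n`. The bound is uniform in `ν`, so it survives averaging against the weights. -/
theorem abs_choose_div_choose_sub_pow_le {n ν j : ℕ} (hν : ν ≤ n) (hj : j < n) :
    |(ν.choose j : ℝ) / n.choose j - ((ν : ℝ) / n) ^ j| ≤ (j : ℝ) ^ 2 / (n - j) := by
  have hn : (0 : ℝ) < n := by exact_mod_cast (Nat.zero_le j).trans_lt hj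
  have hνn : (ν : ℝ) ≤ n := by exact_mod_cast hν
  have hq0 : 0 ≤ (ν : ℝ) / n := by positivity
  have hq1 : (ν : ℝ) / n ≤ 1 := (div_le_one hn).2 hνn
  induction j with
  | zero => simp
  | succ j ih =>
    have ih := ih (by omega)
    have hjn : (j : ℝ) + 1 < n := by exact_mod_cast hj
    have hsucc : ∀ k : ℕ, (k.choose (j + 1) : ℝ) * (j + 1) = k.choose j * (k - j) := by
      intro k
      have h := Nat.choose_succ_right_eq k j
      rcases le_or_gt j k with hk | hk
      · rw [← Nat.cast_sub hk]
        exact_mod_cast h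
      · rw [Nat.choose_eq_zero_of_lt hk, Nat.choose_eq_zero_of_lt (by omega)]
        simp
    have hc : (0 : ℝ) < n.choose j := by exact_mod_cast Nat.choose_pos (by omega)
    have hc1 : (0 : ℝ) < n.choose (j + 1) := by exact_mod_cast Nat.choose_pos hj.le
    set r : ℝ := (ν.choose j : ℝ) / n.choose j with hr
    have hr0 : 0 ≤ r := by positivity
    have hr1 : r ≤ 1 := by
      rw [hr, div_le_one hc]
      exact_mod_cast Nat.choose_le_choose j hν
    have hnj : (0 : ℝ) < n - j := by linarith
    have hnj1 : (0 : ℝ) < n - (j + 1) := by linarith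
    have hrec : (ν.choose (j + 1) : ℝ) / n.choose (j + 1) = r * ((ν - j) / (n - j)) := by
      rw [hr, div_mul_div_comm, ← hsucc, ← hsucc]
      have : (j : ℝ) + 1 ≠ 0 := by positivity
      field_simp
    have hdiff : (ν : ℝ) / n - (ν - j) / (n - j) = j * (n - ν) / (n * (n - j)) := by
      field_simp
      ring
    have hd0 : 0 ≤ (ν : ℝ) / n - (ν - j) / (n - j) := by
      rw [hdiff]
      exact div_nonneg (mul_nonneg (Nat.cast_nonneg _) (by linarith)) (by positivity)
    have hd1 : (ν : ℝ) / n - (ν - j) / (n - j) ≤ j / (n - j) := by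
      rw [hdiff, div_le_div_iff₀ (by positivity) hnj]
      have : (0 : ℝ) ≤ j * ν * (n - j) := by positivity
      nlinarith
    have h1 : |r * ((ν - j) / (n - j)) - (ν : ℝ) / n * r| ≤ j / (n - j) := by
      rw [abs_sub_comm, mul_comm, ← mul_sub, abs_mul, abs_of_nonneg hr0, abs_of_nonneg hd0]
      nlinarith
    have h2 : |(ν : ℝ) / n * r - ((ν : ℝ) / n) ^ (j + 1)| ≤ (j : ℝ) ^ 2 / (n - j) := by
      rw [pow_succ', ← mul_sub, abs_mul, abs_of_nonneg hq0]
      exact (mul_le_of_le_one_left (abs_nonneg _) hq1).trans ih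
    rw [hrec]
    push_cast
    calc |r * ((ν - j) / (n - j)) - ((ν : ℝ) / n) ^ (j + 1)|
        ≤ j / (n - j) + (j : ℝ) ^ 2 / (n - j) := (abs_sub_le _ _ _).trans (add_le_add h1 h2)
      _ = (j + (j : ℝ) ^ 2) / (n - j) := by ring
      _ ≤ ((j : ℝ) + 1) ^ 2 / (n - (j + 1)) := by
        have : (0 : ℝ) ≤ j := Nat.cast_nonneg _
        exact div_le_div₀ (by positivity) (by nlinarith) hnj1 (by linarith)

/-- A completely monotone sequence is the limit of the moment sequences of its Bernstein weights. -/
theorem tendsto_sum_bernsteinWeight_mul_pow {m : ℕ → ℝ}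
    (hm : ∀ n j, 0 ≤ (-1) ^ n * (fwdDiff 1)^[n] m j) (j : ℕ) :
    Tendsto (fun n : ℕ => ∑ ν ∈ Finset.range (n + 1), bernsteinWeight m n ν * ((ν : ℝ) / n) ^ j)
      atTop (𝓝 (m j)) := by
  have hlim : Tendsto (fun n : ℕ => m 0 * ((j : ℝ) ^ 2 / (n - j))) atTop (𝓝 0) := by
    have h : Tendsto (fun n : ℕ => (n : ℝ) - j) atTop atTop :=
      tendsto_atTop_add_const_right _ _ tendsto_natCast_atTop_atTop
    simpa using (h.const_div_atTop ((j : ℝ) ^ 2)).const_mul (m 0)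
  rw [tendsto_iff_norm_sub_tendsto_zero]
  refine squeeze_zero' (Eventually.of_forall fun _ => norm_nonneg _) ?_ hlim
  filter_upwards [eventually_gt_atTop j] with n hn
  rw [eq_sum_choose_div_mul_bernsteinWeight m hn.le, ← Finset.sum_sub_distrib, ← sum_bernsteinWeight m n, Finset.sum_mul]
  refine (norm_sum_le _ _).trans (Finset.sum_le_sum fun ν hν => ?_)
  rw [mul_comm _ (bernsteinWeight m n ν), ← mul_sub, norm_mul,
    Real.norm_of_nonneg (bernsteinWeight_nonneg hm n ν), norm_sub_rev]
  exact mul_le_mul_of_nonneg_left (abs_choose_div_choose_sub_pow_le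
    (Nat.lt_succ_iff.1 (Finset.mem_range.1 hν)) hn) (bernsteinWeight_nonneg hm n ν)

/-- Expand in a geometric series and pass to the limit termwise; since the weights sum to `m 0`, the
terms are dominated by `w ^ j * m 0`. -/
theorem tendsto_sum_bernsteinWeight_mul_inv {m : ℕ → ℝ}
    (hm : ∀ n j, 0 ≤ (-1) ^ n * (fwdDiff 1)^[n] m j) {w : ℝ} (hw0 : 0 ≤ w) (hw1 : w < 1) :
    Tendsto (fun n : ℕ => ∑ ν ∈ Finset.range (n + 1),
      bernsteinWeight m n ν * (1 - w * ((ν : ℝ) / n))⁻¹) atTop (𝓝 (∑' j, w ^ j * m j)) := by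
  have hq0 : ∀ n ν : ℕ, 0 ≤ (ν : ℝ) / n := fun n ν => by positivity
  have hq1 : ∀ n, ∀ ν ∈ Finset.range (n + 1), (ν : ℝ) / n ≤ 1 := by
    intro n ν hν
    refine div_le_one_of_le₀ ?_ (Nat.cast_nonneg _)
    exact_mod_cast Nat.lt_succ_iff.1 (Finset.mem_range.1 hν)
  have hgeom : ∀ n : ℕ, ∑ ν ∈ Finset.range (n + 1),
      bernsteinWeight m n ν * (1 - w * ((ν : ℝ) / n))⁻¹ =
      ∑' j, w ^ j * ∑ ν ∈ Finset.range (n + 1), bernsteinWeight m n ν * ((ν : ℝ) / n) ^ j := by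
    intro n
    have h : HasSum (fun j => ∑ ν ∈ Finset.range (n + 1),
        bernsteinWeight m n ν * (w * ((ν : ℝ) / n)) ^ j)
        (∑ ν ∈ Finset.range (n + 1), bernsteinWeight m n ν * (1 - w * ((ν : ℝ) / n))⁻¹) := by
      refine hasSum_sum fun ν hν => HasSum.mul_left _ (hasSum_geometric_of_lt_one
        (mul_nonneg hw0 (hq0 n ν)) ?_)
      exact (mul_le_of_le_one_right hw0 (hq1 n ν hν)).trans_lt hw1
    rw [← h.tsum_eq]
    refine tsum_congr fun j => ?_
    rw [Finset.mul_sum]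
    refine Finset.sum_congr rfl fun ν _ => ?_
    rw [mul_pow]
    ring
  simp_rw [hgeom]
  refine tendsto_tsum_of_dominated_convergence (bound := fun j => w ^ j * m 0)
    ((summable_geometric_of_lt_one hw0 hw1).mul_right _)
    (fun j => (tendsto_sum_bernsteinWeight_mul_pow hm j).const_mul _)
    (Eventually.of_forall fun n j => ?_)
  rw [norm_mul, norm_pow, Real.norm_of_nonneg hw0]
  refine mul_le_mul_of_nonneg_left ?_ (pow_nonneg hw0 j)
  rw [← sum_bernsteinWeight m n]
  refine (norm_sum_le _ _).trans (Finset.sum_le_sum fun ν hν => ?_)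
  have hb := bernsteinWeight_nonneg hm n ν
  rw [Real.norm_of_nonneg (mul_nonneg hb (pow_nonneg (hq0 n ν) j))]
  exact mul_le_of_le_one_right hb (pow_le_one₀ (hq0 n ν) (hq1 n ν hν))

/-- The generating function of a completely monotone sequence gives an element of the cone. -/
theorem mul_tsum_mem_stieltjesCone {m : ℕ → ℝ} (hm : ∀ n j, 0 ≤ (-1) ^ n * (fwdDiff 1)^[n] m j)
    {h : ℝ} (hh : 0 < h) :
    (fun x : Ioi (0 : ℝ) => (x : ℝ) * ∑' j, (1 + x * h)⁻¹ ^ (j + 1) * m j) ∈ stieltjesCone := by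
  -- With `w = (1 + x h)⁻¹` and `q = ν / n`, one has `x w / (1 - w q) = h⁻¹ * (x / (x + (1 - q) /
  -- h))`. The node `q = 1` gives the degenerate atom `t = 0`.
  refine isClosed_stieltjesCone.mem_of_tendsto
    (f := fun n : ℕ => ∑ ν ∈ Finset.range (n + 1), fun x : Ioi (0 : ℝ) =>
      (bernsteinWeight m n ν / h) * stieltjesAtom ((1 - (ν : ℝ) / n) / h) x)
    (b := atTop) ?_ (Eventually.of_forall fun n => sum_mem fun ν hν => ?_)
  · rw [tendsto_pi_nhds]
    intro x
    have hx : (0 : ℝ) < x := x.2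
    have hxh : 0 < (x : ℝ) * h := mul_pos hx hh
    set w : ℝ := (1 + x * h)⁻¹ with hw
    have hw0 : 0 < w := by positivity
    have hw1 : w < 1 := inv_lt_one_of_one_lt₀ (by linarith)
    have hlim := (tendsto_sum_bernsteinWeight_mul_inv hm hw0.le hw1).const_mul ((x : ℝ) * w)
    have hts : (x : ℝ) * ∑' j, w ^ (j + 1) * m j = x * w * ∑' j, w ^ j * m j := by
      rw [mul_assoc, ← tsum_mul_left (a := w)]
      congr 1
      exact tsum_congr fun j => by ring
    rw [hts]
    refine hlim.congr fun n => ?_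
    rw [Finset.sum_apply, Finset.mul_sum]
    refine Finset.sum_congr rfl fun ν hν => ?_
    have hq : (ν : ℝ) / n ≤ 1 := by
      refine div_le_one_of_le₀ ?_ (Nat.cast_nonneg _)
      exact_mod_cast Nat.lt_succ_iff.1 (Finset.mem_range.1 hν)
    generalize (ν : ℝ) / n = q at hq
    have h1 : (1 + x * h - q : ℝ) ≠ 0 := by linarith
    have h2 : 1 - w * q = w * (1 + x * h - q) := by
      rw [hw]
      field_simp
    have h3 : (x : ℝ) + (1 - q) / h = (1 + x * h - q) / h := by
      field_simp
      ring
    rw [h2, stieltjesAtom, h3]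
    field_simp
  · refine smul_mem_stieltjesCone (stieltjesAtom_mem ?_)
      (div_nonneg (bernsteinWeight_nonneg hm n ν) hh.le)
    refine div_nonneg (sub_nonneg.2 (div_le_one_of_le₀ ?_ (Nat.cast_nonneg _))) hh.le
    exact_mod_cast Nat.lt_succ_iff.1 (Finset.mem_range.1 hν)

/-! ### Finite differences of completely monotonic and Bernstein functions -/

theorem hasDerivAt_fwdDiff_iterate {u v : ℝ → ℝ} (huv : ∀ x, 0 < x → HasDerivAt u (v x) x) {h : ℝ}
    (hh : 0 ≤ h) (n : ℕ) {x : ℝ} (hx : 0 < x) :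
    HasDerivAt ((fwdDiff h)^[n] u) ((fwdDiff h)^[n] v x) x := by
  induction n generalizing x with
  | zero => exact huv x hx
  | succ n ih =>
    rw [Function.iterate_succ_apply', Function.iterate_succ_apply']
    exact ((ih (add_pos_of_pos_of_nonneg hx hh)).comp_add_const x h).sub (ih hx)

theorem mul_fwdDiff_iterate_succ_nonneg {u v : ℝ → ℝ} (huv : ∀ x, 0 < x → HasDerivAt u (v x) x)
    {h : ℝ} (hh : 0 ≤ h) {n : ℕ} {σ : ℝ} (hv : ∀ x, 0 < x → 0 ≤ σ * (fwdDiff h)^[n] v x) {x : ℝ}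
    (hx : 0 < x) : 0 ≤ σ * (fwdDiff h)^[n + 1] u x := by
  have hd : ∀ y, 0 < y → HasDerivAt (fun y => σ * (fwdDiff h)^[n] u y)
      (σ * (fwdDiff h)^[n] v y) y := fun y hy =>
    (hasDerivAt_fwdDiff_iterate huv hh n hy).const_mul σ
  have hmono : MonotoneOn (fun y => σ * (fwdDiff h)^[n] u y) (Ioi 0) := by
    refine monotoneOn_of_hasDerivWithinAt_nonneg (f' := fun y => σ * (fwdDiff h)^[n] v y)
      (convex_Ioi 0) (fun y hy => (hd y hy).continuousAt.continuousWithinAt) ?_ ?_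
    · intro y hy
      rw [interior_Ioi] at hy
      exact (hd y hy).hasDerivWithinAt
    · intro y hy
      rw [interior_Ioi] at hy
      exact hv y hy
  have := hmono hx (mem_Ioi.2 (add_pos_of_pos_of_nonneg hx hh)) (le_add_of_nonneg_right hh)
  rw [Function.iterate_succ_apply', fwdDiff, mul_sub]
  simpa using this

/-- Differences commute with differentiation, so induction passes to the derivative and recovers the
sign by monotonicity. Keeping `σ` abstract lets one sign serve the whole induction. -/
theorem mul_fwdDiff_iterate_nonneg {u : ℝ → ℝ} (hu : ContDiffOn ℝ ∞ u (Ioi 0)) {n : ℕ} {σ : ℝ}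
    (hσ : ∀ x, 0 < x → 0 ≤ σ * iteratedDerivWithin n u (Ioi 0) x) {h : ℝ} (hh : 0 ≤ h) {x : ℝ}
    (hx : 0 < x) : 0 ≤ σ * (fwdDiff h)^[n] u x := by
  induction n generalizing u x with
  | zero => simpa using hσ x hx
  | succ n ih =>
    refine mul_fwdDiff_iterate_succ_nonneg (v := derivWithin u (Ioi 0)) (fun y hy => ?_) hh
      (fun y hy => ?_) hx
    · exact ((hu.differentiableOn (by simp)) y hy).hasDerivWithinAt.hasDerivAt (Ioi_mem_nhds hy)
    · refine ih (hu.derivWithin (uniqueDiffOn_Ioi 0) (by simp)) (fun z hz => ?_) hy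
      rw [← iteratedDerivWithin_succ']
      exact hσ z hz

theorem IsCompletelyMonotonic.antitoneOn {k : ℝ → ℝ} (hk : IsCompletelyMonotonic k) :
    AntitoneOn k (Ioi 0) := by
  intro x hx y hy hxy
  have := mul_fwdDiff_iterate_nonneg hk.1 (hk.2 1) (sub_nonneg.2 hxy) hx
  simp only [pow_one, Function.iterate_one, fwdDiff, add_sub_cancel] at this
  linarith

theorem fwdDiff_iterate_comp_affine (u : ℝ → ℝ) (h : ℝ) (n i : ℕ) :
    (fwdDiff 1)^[n] (fun i : ℕ => u ((i + 1) * h)) i = (fwdDiff h)^[n] u ((i + 1) * h) := by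
  induction n generalizing i with
  | zero => rfl
  | succ n ih =>
    rw [Function.iterate_succ_apply', Function.iterate_succ_apply', fwdDiff, fwdDiff, ih, ih]
    push_cast
    ring_nf

section Bernstein

variable {b : ℝ → ℝ}

theorem IsBernstein.monotoneOn (hb : IsBernstein b) : MonotoneOn b (Ici 0) := by
  obtain ⟨-, hc, k, hk, hd⟩ := hb
  refine monotoneOn_of_hasDerivWithinAt_nonneg (f' := k) (convex_Ici 0) hc ?_ ?_
  · intro y hy
    rw [interior_Ici] at hy
    exact (hd y hy).hasDerivWithinAt
  · intro y hy
    rw [interior_Ici] at hy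
    simpa using hk.1.2 0 y hy

/-- The derivative is decreasing, so beyond `1` the slope is at most `k 1`; before `1` monotonicity
suffices. -/
theorem IsBernstein.exists_le_affine (hb : IsBernstein b) :
    ∃ A B : ℝ, 0 ≤ A ∧ 0 ≤ B ∧ ∀ t, 0 ≤ t → b t ≤ A + B * t := by
  have hmono := hb.monotoneOn
  obtain ⟨h0, hc, k, hk, hd⟩ := hb
  have hk1 : 0 ≤ k 1 := by simpa using hk.1.2 0 1 (mem_Ioi.2 one_pos)
  refine ⟨b 1, k 1, h0 1 (mem_Ici.2 zero_le_one), hk1, fun t ht => ?_⟩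
  rcases le_total t 1 with h | h
  · have := hmono ht (mem_Ici.2 zero_le_one) h
    nlinarith
  · have hanti : AntitoneOn (fun y => b y - k 1 * y) (Ici 1) := by
      refine antitoneOn_of_hasDerivWithinAt_nonpos (f' := fun y => k y - k 1) (convex_Ici 1) ?_ ?_ ?_
      · exact (hc.mono (Ici_subset_Ici.2 zero_le_one)).sub (by fun_prop)
      · intro y hy
        rw [interior_Ici] at hy
        have hy0 : 0 < y := one_pos.trans hy
        have h2 : HasDerivAt (fun y => k 1 * y) (k 1) y := by
          simpa using (hasDerivAt_id y).const_mul (k 1)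
        exact ((hd y hy0).sub h2).hasDerivWithinAt
      · intro y hy
        rw [interior_Ici] at hy
        exact sub_nonpos.2 (hk.1.antitoneOn (mem_Ioi.2 one_pos)
          (mem_Ioi.2 (one_pos.trans hy)) hy.le)
    have := hanti (mem_Ici.2 le_rfl) h h
    simp only at this
    linarith

/-- The increments of a Bernstein function along an arithmetic progression form a completely
monotone sequence. -/
theorem IsBernstein.increments_completelyMonotone (hb : IsBernstein b) {h : ℝ} (hh : 0 < h)
    (n j : ℕ) :
    0 ≤ (-1) ^ n * (fwdDiff 1)^[n] (fun i : ℕ => b ((i + 2) * h) - b ((i + 1) * h)) j := by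
  obtain ⟨-, -, k, hk, hd⟩ := hb
  have h1 : (fun i : ℕ => b ((i + 2) * h) - b ((i + 1) * h)) =
      fwdDiff 1 (fun i : ℕ => b ((i + 1) * h)) := by
    ext i
    simp only [fwdDiff]
    push_cast
    ring_nf
  -- The progression starts at `h`, not `0`, because the derivative is only available on the open
  -- half-line.
  rw [h1, ← Function.iterate_succ_apply, fwdDiff_iterate_comp_affine]
  exact mul_fwdDiff_iterate_succ_nonneg hd hh.le
    (fun x hx => mul_fwdDiff_iterate_nonneg hk.1.1 (hk.1.2 n) hh.le hx) (by positivity)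

end Bernstein

/-! ### Riemann sums: complete Bernstein functions lie in the cone -/

/-- The integral over the positive half-line of a step function with steps of length `1 / N`. -/
theorem integral_floor_mul {a : ℕ → ℝ} (ha : Summable a) (ha0 : ∀ j, 0 ≤ a j) {N : ℝ}
    (hN : 0 < N) : ∫ t in Ioi (0 : ℝ), a ⌊t * N⌋₊ = N⁻¹ * ∑' j, a j := by
  let s : ℕ → Set ℝ := fun j => Ico (j / N) ((j + 1) / N)
  have hmem : ∀ j t, t ∈ s j ↔ 0 ≤ t ∧ ⌊t * N⌋₊ = j := by
    intro j t
    simp only [s, mem_Ico, div_le_iff₀ hN, lt_div_iff₀ hN]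
    constructor
    · rintro ⟨h1, h2⟩
      have h3 : 0 ≤ t * N := (Nat.cast_nonneg j).trans h1
      exact ⟨nonneg_of_mul_nonneg_left h3 hN, (Nat.floor_eq_iff h3).2 ⟨h1, h2⟩⟩
    · rintro ⟨h1, h2⟩
      exact (Nat.floor_eq_iff (by positivity)).1 h2
  have hU : ⋃ j, s j = Ici (0 : ℝ) := by
    ext t
    simp only [mem_iUnion, hmem, mem_Ici]
    exact ⟨fun ⟨_, h, _⟩ => h, fun h => ⟨_, h, rfl⟩⟩
  have hdisj : Pairwise (Function.onFun Disjoint s) := by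
    intro i j hij
    refine Set.disjoint_left.2 fun t hi hj => hij ?_
    rw [← ((hmem i t).1 hi).2, ((hmem j t).1 hj).2]
  have hmeas : ∀ j, MeasurableSet (s j) := fun j => measurableSet_Ico
  have hvol : ∀ j, (volume : Measure ℝ).real (s j) = N⁻¹ := by
    intro j
    have : ((j : ℝ) + 1) / N - j / N = N⁻¹ := by
      field_simp
      ring
    simp only [s, Measure.real, Real.volume_Ico, this]
    exact ENNReal.toReal_ofReal (by positivity)
  have heq : ∀ j, EqOn (fun t : ℝ => a ⌊t * N⌋₊) (fun _ => a j) (s j) := by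
    intro j t ht
    simp only [((hmem j t).1 ht).2]
  have hint : ∀ j, ∫ t in s j, a ⌊t * N⌋₊ = N⁻¹ * a j := by
    intro j
    rw [setIntegral_congr_fun (hmeas j) (heq j), setIntegral_const, hvol, smul_eq_mul]
  have hIo : ∀ j, IntegrableOn (fun t : ℝ => a ⌊t * N⌋₊) (s j) := by
    intro j
    refine (integrableOn_congr_fun (heq j) (hmeas j)).2 ?_
    exact integrableOn_const (by simp [s])
  have hI : IntegrableOn (fun t : ℝ => a ⌊t * N⌋₊) (⋃ j, s j) := by
    refine integrableOn_iUnion_of_summable_integral_norm hIo ?_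
    simp_rw [Real.norm_of_nonneg (ha0 _), hint]
    exact ha.mul_left _
  have h := hasSum_integral_iUnion hmeas hdisj hI
  rw [hU, integral_Ici_eq_integral_Ioi] at h
  simp_rw [hint] at h
  rw [← h.tsum_eq, tsum_mul_left]

theorem tendsto_inv_one_add_div_pow_floor (x : ℝ) {t : ℝ} (ht : 0 ≤ t) :
    Tendsto (fun N : ℝ => (1 + x / N)⁻¹ ^ (⌊t * N⌋₊ + 1)) atTop (𝓝 (Real.exp (-x * t))) := by
  have h1 : Tendsto (fun N : ℝ => ((⌊t * N⌋₊ : ℝ) + 1) / N) atTop (𝓝 t) := by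
    have := (tendsto_nat_floor_mul_div_atTop ht).add tendsto_inv_atTop_zero
    rw [add_zero] at this
    refine this.congr fun N => ?_
    ring
  have h2 := (h1.mul (Real.tendsto_mul_log_one_add_div_atTop x)).neg
  have h3 : Tendsto (fun N : ℝ => 1 + x / N) atTop (𝓝 1) := by
    simpa using (tendsto_id.const_div_atTop x).const_add (1 : ℝ)
  have h4 := (Real.continuous_exp.tendsto _).comp h2
  rw [show -(t * x) = -x * t by ring] at h4
  refine h4.congr' ?_
  filter_upwards [h3.eventually (lt_mem_nhds zero_lt_one), eventually_gt_atTop 0] with N hN hN0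
  have : ((⌊t * N⌋₊ : ℝ) + 1) / N * (N * Real.log (1 + x / N)) =
      ((⌊t * N⌋₊ + 1 : ℕ) : ℝ) * Real.log (1 + x / N) := by
    push_cast
    field_simp
  simp only [Function.comp_apply]
  rw [this, Real.exp_neg, Real.exp_nat_mul, Real.exp_log hN, inv_pow]

/-- Bernoulli's inequality `1 + x ≤ (1 + x / N) ^ N` gives the bound `(1 + x) ^ (-t)`, independent
of `N`, for dominated convergence. -/
theorem inv_one_add_div_pow_floor_le {x t N : ℝ} (hx : 0 ≤ x) (ht : 0 ≤ t) (hN : 1 ≤ N) :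
    (1 + x / N)⁻¹ ^ (⌊t * N⌋₊ + 1) ≤ Real.exp (-Real.log (1 + x) * t) := by
  have hN0 : 0 < N := one_pos.trans_le hN
  have hxN : 0 ≤ x / N := div_nonneg hx hN0.le
  have h1 : 1 + x ≤ (1 + x / N) ^ N := by
    have := one_add_mul_self_le_rpow_one_add (by linarith : -1 ≤ x / N) hN
    rwa [mul_div_cancel₀ _ hN0.ne'] at this
  have h2 : (1 + x) ^ t ≤ (1 + x / N) ^ (⌊t * N⌋₊ + 1) := by
    calc (1 + x) ^ t ≤ ((1 + x / N) ^ N) ^ t := Real.rpow_le_rpow (by linarith) h1 ht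
      _ = (1 + x / N) ^ (t * N) := by rw [← Real.rpow_mul (by linarith), mul_comm]
      _ ≤ (1 + x / N) ^ ((⌊t * N⌋₊ + 1 : ℕ) : ℝ) := by
        refine Real.rpow_le_rpow_of_exponent_le (by linarith) ?_
        push_cast
        exact (Nat.lt_floor_add_one _).le
      _ = _ := Real.rpow_natCast _ _
  rw [inv_pow, neg_mul, Real.exp_neg, ← Real.rpow_def_of_pos (by linarith)]
  exact inv_anti₀ (Real.rpow_pos_of_pos (by linarith) _) h2

theorem integrableOn_exp_mul_affine (A B : ℝ) {c : ℝ} (hc : 0 < c) :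
    IntegrableOn (fun t => Real.exp (-c * t) * (A + B * t)) (Ioi 0) := by
  have h1 : IntegrableOn (fun t => Real.exp (-c * t)) (Ioi 0) :=
    integrableOn_exp_mul_Ioi (by linarith) 0
  have h2 : IntegrableOn (fun t => t * Real.exp (-c * t)) (Ioi 0) := by
    simpa using integrableOn_rpow_mul_exp_neg_mul_rpow (s := 1) (p := 1) (by norm_num) one_pos hc
  refine IntegrableOn.congr_fun ((h1.mul_const A).add (h2.mul_const B)) (fun t _ => ?_)
    measurableSet_Ioi
  simp only [Pi.add_apply]
  ring

/-- For `w = (1 + x h)⁻¹` the factor `w⁻¹ - 1` is `x h`: a discrete form of integrating `exp (-x t)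
* b' t` by parts. -/
theorem summation_by_parts {w : ℝ} (hw0 : 0 < w) (hw1 : w < 1) {b : ℕ → ℝ} {A B : ℝ}
    (hb0 : ∀ j, 0 ≤ b j) (hb : ∀ j, b j ≤ A + B * j) :
    Summable (fun j => w ^ (j + 1) * b j) ∧
      ∑' j, w ^ (j + 1) * (b (j + 1) - b j) = (w⁻¹ - 1) * ∑' j, w ^ (j + 1) * b j - b 0 := by
  have hs : Summable (fun j => w ^ (j + 1) * b j) := by
    have h1 : Summable fun j : ℕ => w ^ j := summable_geometric_of_lt_one hw0.le hw1
    have h2 : Summable fun j : ℕ => (j : ℝ) ^ 1 * w ^ j :=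
      summable_pow_mul_geometric_of_norm_lt_one 1 (by rwa [Real.norm_of_nonneg hw0.le])
    refine Summable.of_nonneg_of_le (fun j => mul_nonneg (by positivity) (hb0 j)) (fun j => ?_)
      (((h1.mul_left A).add (h2.mul_left B)).mul_left w)
    calc w ^ (j + 1) * b j ≤ w ^ (j + 1) * (A + B * j) :=
          mul_le_mul_of_nonneg_left (hb j) (by positivity)
      _ = _ := by ring
  refine ⟨hs, ?_⟩
  have hs' : Summable fun j => w ^ (j + 2) * b (j + 1) := (summable_nat_add_iff 1).2 hs
  have h0 := hs.tsum_eq_zero_add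
  have h1 : ∑' j, w ^ (j + 1) * (b (j + 1) - b j) =
      w⁻¹ * ∑' j, w ^ (j + 2) * b (j + 1) - ∑' j, w ^ (j + 1) * b j := by
    rw [← tsum_mul_left, ← (hs'.mul_left _).tsum_sub hs]
    refine tsum_congr fun j => ?_
    field_simp
    ring
  rw [h1, h0]
  simp only [zero_add, pow_one]
  field_simp
  ring

/-- Riemann sums of the Laplace transform of a Bernstein function. -/
theorem IsBernstein.tendsto_riemann_sum_laplaceTransform {b : ℝ → ℝ} (hb : IsBernstein b) {x : ℝ}
    (hx : 0 < x) :
    Tendsto (fun N : ℕ => ((N : ℝ) + 1)⁻¹ *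
      ∑' j : ℕ, (1 + x / ((N : ℝ) + 1))⁻¹ ^ (j + 1) * b ((j + 1) * ((N : ℝ) + 1)⁻¹))
      atTop (𝓝 (laplaceTransform b x)) := by
  obtain ⟨A, B, hA, hB, hAB⟩ := hb.exists_le_affine
  have hN0 : ∀ N : ℕ, (0 : ℝ) < (N : ℝ) + 1 := fun N => by positivity
  have hb0 : ∀ (N j : ℕ), 0 ≤ b ((j + 1) * ((N : ℝ) + 1)⁻¹) := fun N j =>
    hb.1 _ (mem_Ici.2 (by positivity))
  have heq : ∀ N : ℕ, ((N : ℝ) + 1)⁻¹ *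
      ∑' j : ℕ, (1 + x / ((N : ℝ) + 1))⁻¹ ^ (j + 1) * b ((j + 1) * ((N : ℝ) + 1)⁻¹) =
      ∫ t in Ioi (0 : ℝ), (1 + x / ((N : ℝ) + 1))⁻¹ ^ (⌊t * ((N : ℝ) + 1)⌋₊ + 1) *
        b ((⌊t * ((N : ℝ) + 1)⌋₊ + 1) * ((N : ℝ) + 1)⁻¹) := by
    intro N
    have hw1 : (1 + x / ((N : ℝ) + 1))⁻¹ < 1 :=
      inv_lt_one_of_one_lt₀ (lt_add_of_pos_right _ (by positivity))
    -- The step is at most `1`, so the argument is at most `j + 1`, whence the constants `A + B` and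
    -- `B`.
    have hsum := (summation_by_parts (by positivity) hw1 (hb0 N)
      (A := A + B) (B := B) fun j => ?_).1
    · exact (integral_floor_mul hsum (fun j => mul_nonneg (by positivity) (hb0 N j)) (hN0 N)).symm
    · refine (hAB _ (by positivity)).trans ?_
      have h1 : ((N : ℝ) + 1)⁻¹ ≤ 1 := inv_le_one_of_one_le₀ (by simp)
      have h2 : ((j : ℝ) + 1) * ((N : ℝ) + 1)⁻¹ ≤ j + 1 :=
        mul_le_of_le_one_right (by positivity) h1
      nlinarith [mul_le_mul_of_nonneg_left h2 hB]
  simp_rw [heq]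
  have hc : 0 < Real.log (1 + x) := Real.log_pos (by linarith)
  have hNtop : Tendsto (fun N : ℕ => (N : ℝ) + 1) atTop atTop :=
    tendsto_atTop_add_const_right _ _ tendsto_natCast_atTop_atTop
  refine tendsto_integral_of_dominated_convergence
    (fun t => Real.exp (-Real.log (1 + x) * t) * ((A + B) + B * t)) (fun N => ?_)
    (integrableOn_exp_mul_affine _ _ hc) (fun N => ?_) ?_
  · have hm : Measurable fun t : ℝ => ⌊t * ((N : ℝ) + 1)⌋₊ :=
      Nat.measurable_floor.comp (measurable_id.mul_const _)
    exact ((measurable_from_nat (f := fun j : ℕ => (1 + x / ((N : ℝ) + 1))⁻¹ ^ (j + 1) *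
      b ((j + 1) * ((N : ℝ) + 1)⁻¹))).comp hm).aestronglyMeasurable
  · refine (ae_restrict_iff' measurableSet_Ioi).2 (Eventually.of_forall fun t ht => ?_)
    have ht : 0 < t := ht
    rw [Real.norm_of_nonneg (mul_nonneg (by positivity) (hb0 N _))]
    refine mul_le_mul (inv_one_add_div_pow_floor_le hx.le ht.le (by simp)) ?_ (hb0 N _)
      (Real.exp_nonneg _)
    refine (hAB _ (by positivity)).trans ?_
    have h1 : ((N : ℝ) + 1)⁻¹ ≤ 1 := inv_le_one_of_one_le₀ (by simp)
    have h2 : ((⌊t * ((N : ℝ) + 1)⌋₊ : ℝ) + 1) * ((N : ℝ) + 1)⁻¹ ≤ t + 1 := by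
      have h3 := Nat.floor_le (a := t * ((N : ℝ) + 1)) (by positivity)
      rw [← div_eq_mul_inv, div_le_iff₀ (hN0 N)]
      nlinarith [(Nat.cast_nonneg N : (0 : ℝ) ≤ N)]
    nlinarith [mul_le_mul_of_nonneg_left h2 hB]
  · refine (ae_restrict_iff' measurableSet_Ioi).2 (Eventually.of_forall fun t ht => ?_)
    have ht : 0 < t := ht
    refine ((tendsto_inv_one_add_div_pow_floor x ht.le).comp hNtop).mul ?_
    have hcont : ContinuousAt b t := hb.2.1.continuousAt (Ici_mem_nhds ht)
    have h1 : Tendsto (fun N : ℝ => ((⌊t * N⌋₊ : ℝ) + 1) * N⁻¹) atTop (𝓝 t) := by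
      have := (tendsto_nat_floor_mul_div_atTop ht.le).add tendsto_inv_atTop_zero
      rw [add_zero] at this
      refine this.congr fun N => ?_
      ring
    exact hcont.tendsto.comp (h1.comp hNtop)

/-- A complete Bernstein function restricts to an element of the cone. -/
theorem IsCompleteBernstein.mem_stieltjesCone {f : ℝ → ℝ} (hf : IsCompleteBernstein f) :
    (fun x : Ioi (0 : ℝ) => f x) ∈ stieltjesCone := by
  obtain ⟨-, b, hb, hfb⟩ := hf
  obtain ⟨A, B, hA, hB, hAB⟩ := hb.exists_le_affine
  have hN0 : ∀ N : ℕ, (0 : ℝ) < ((N : ℝ) + 1)⁻¹ := fun N => by positivity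
  refine isClosed_stieltjesCone.mem_of_tendsto (b := atTop)
    -- The linear term cancels the boundary term of the Abel summation, so the sum is exactly `x ^
    -- 2` times the Riemann sum.
    (f := fun N : ℕ => (fun x : Ioi (0 : ℝ) => b ((N : ℝ) + 1)⁻¹ * (x : ℝ)) +
      fun x : Ioi (0 : ℝ) => (x : ℝ) * ∑' j : ℕ, (1 + x * ((N : ℝ) + 1)⁻¹)⁻¹ ^ (j + 1) *
        (b ((j + 2) * ((N : ℝ) + 1)⁻¹) - b ((j + 1) * ((N : ℝ) + 1)⁻¹)))
    ?_ (Eventually.of_forall fun N => add_mem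
      (smul_mem_stieltjesCone coe_mem_stieltjesCone (hb.1 _ (mem_Ici.2 (hN0 N).le)))
      (mul_tsum_mem_stieltjesCone (hb.increments_completelyMonotone (hN0 N)) (hN0 N)))
  rw [tendsto_pi_nhds]
  intro x
  have hx : (0 : ℝ) < x := x.2
  rw [hfb x hx]
  refine ((hb.tendsto_riemann_sum_laplaceTransform hx).const_mul ((x : ℝ) ^ 2)).congr fun N => ?_
  have hw1 : (1 + (x : ℝ) * ((N : ℝ) + 1)⁻¹)⁻¹ < 1 :=
    inv_lt_one_of_one_lt₀ (lt_add_of_pos_right _ (by positivity))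
  have hsum := (summation_by_parts (by positivity) hw1
    (b := fun j : ℕ => b ((j + 1) * ((N : ℝ) + 1)⁻¹))
    (A := A + B) (B := B) (fun j => hb.1 _ (mem_Ici.2 (by positivity))) fun j => ?_).2
  · simp only [Pi.add_apply]
    have h2 : ∀ j : ℕ, ((j + 1 : ℕ) : ℝ) + 1 = j + 2 := fun j => by push_cast; ring
    simp only [h2, Nat.cast_zero, zero_add, one_mul, inv_inv, add_sub_cancel_left] at hsum
    rw [hsum, div_eq_mul_inv]
    ring
  · refine (hAB _ (by positivity)).trans ?_
    have h1 : ((N : ℝ) + 1)⁻¹ ≤ 1 := inv_le_one_of_one_le₀ (by simp)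
    have h2 : ((j : ℝ) + 1) * ((N : ℝ) + 1)⁻¹ ≤ j + 1 :=
      mul_le_of_le_one_right (by positivity) h1
    nlinarith [mul_le_mul_of_nonneg_left h2 hB]

/-! ### Mixtures of elementary Bernstein functions -/

/-- The Bernstein function `t ↦ (1 + τ) ∫₀ᵗ exp (-τ r) dr`. -/
noncomputable def bernsteinKernel (τ t : ℝ) : ℝ :=
  if τ = 0 then t else (1 + τ) * (1 - Real.exp (-τ * t)) / τ

theorem measurable_bernsteinKernel : Measurable fun p : ℝ × ℝ => bernsteinKernel p.1 p.2 :=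
  Measurable.ite (measurable_fst (measurableSet_singleton 0)) measurable_snd (by fun_prop)

theorem bernsteinKernel_nonneg {τ t : ℝ} (hτ : 0 ≤ τ) (ht : 0 ≤ t) : 0 ≤ bernsteinKernel τ t := by
  unfold bernsteinKernel
  split_ifs
  · exact ht
  · have : Real.exp (-τ * t) ≤ 1 := Real.exp_le_one_iff.2 (by nlinarith)
    exact div_nonneg (mul_nonneg (by linarith) (by linarith)) hτ

/-- The factor `1 + τ` is harmless: `(1 - exp (-τ t)) / τ ≤ t` and `1 - exp (-τ t) ≤ 1`. Uniformity
in `τ` makes the kernels integrable against any finite measure. -/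
theorem bernsteinKernel_le {τ t : ℝ} (hτ : 0 ≤ τ) : bernsteinKernel τ t ≤ 1 + t := by
  unfold bernsteinKernel
  split_ifs with h
  · linarith
  · have hτ' : 0 < τ := lt_of_le_of_ne hτ (Ne.symm h)
    have h1 := Real.add_one_le_exp (-τ * t)
    have h2 := Real.exp_pos (-τ * t)
    rw [div_le_iff₀ hτ']
    nlinarith

theorem hasDerivAt_bernsteinKernel (τ t : ℝ) :
    HasDerivAt (bernsteinKernel τ) ((1 + τ) * Real.exp (-τ * t)) t := by
  by_cases h : τ = 0
  · subst h
    have : bernsteinKernel 0 = fun t => t := by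
      ext
      simp [bernsteinKernel]
    rw [this]
    simpa using hasDerivAt_id' t
  · have : bernsteinKernel τ = fun t => (1 + τ) * (1 - Real.exp (-τ * t)) / τ := by
      ext
      simp [bernsteinKernel, h]
    rw [this]
    have h1 : HasDerivAt (fun t => -τ * t) (-τ) t := by
      simpa using (hasDerivAt_id' t).const_mul (-τ)
    convert! ((h1.exp.const_sub 1).const_mul (1 + τ)).div_const τ using 1
    field_simp

theorem integral_exp_mul_bernsteinKernel {τ x : ℝ} (hτ : 0 ≤ τ) (hx : 0 < x) :
    ∫ t in Ioi (0 : ℝ), Real.exp (-x * t) * bernsteinKernel τ t = (1 + τ) / (x * (x + τ)) := by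
  by_cases h : τ = 0
  · subst h
    have h1 := Real.integral_rpow_mul_exp_neg_mul_Ioi (a := 2) two_pos hx
    have h2 : ∫ t in Ioi (0 : ℝ), Real.exp (-x * t) * bernsteinKernel 0 t =
        ∫ t in Ioi (0 : ℝ), t ^ ((2 : ℝ) - 1) * Real.exp (-(x * t)) := by
      refine setIntegral_congr_fun measurableSet_Ioi fun t _ => ?_
      rw [show (2 : ℝ) - 1 = 1 by norm_num]
      simp [bernsteinKernel, mul_comm]
    rw [h2, h1, Real.Gamma_two, Real.rpow_two]
    field_simp
    ring
  · have hτ' : 0 < τ := lt_of_le_of_ne hτ (Ne.symm h)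
    have h1 : ∀ t, Real.exp (-x * t) * bernsteinKernel τ t =
        (1 + τ) / τ * (Real.exp (-x * t) - Real.exp (-(x + τ) * t)) := by
      intro t
      rw [show -(x + τ) * t = -x * t + -τ * t by ring, Real.exp_add]
      simp only [bernsteinKernel, h, if_false]
      ring
    simp_rw [h1]
    rw [integral_const_mul, integral_sub (integrableOn_exp_mul_Ioi (by linarith) 0)
      (integrableOn_exp_mul_Ioi (by linarith) 0), integral_exp_mul_Ioi (by linarith),
      integral_exp_mul_Ioi (by linarith)]
    simp only [mul_zero, Real.exp_zero]
    field_simp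
    ring

section Laplace

variable {Ω : Type*} [MeasurableSpace Ω] {μ : Measure Ω} {τ : Ω → ℝ}

/-- For `s > 0` the integrand `exp (-s τ)` is at most `1`. Hence the moment generating function of
`-τ` is analytic on `t > 0`, which supplies all derivatives of the mixture. -/
theorem mem_interior_integrableExpSet_neg [IsFiniteMeasure μ] (hτ : Measurable τ)
    (hτ0 : ∀ z, 0 ≤ τ z) {t : ℝ} (ht : 0 < t) :
    t ∈ interior (integrableExpSet (fun z => -τ z) μ) := by
  refine interior_maximal (s := integrableExpSet (fun z => -τ z) μ) (t := Ioi 0) (fun s hs => ?_)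
    isOpen_Ioi ht
  have hs : 0 < s := hs
  refine Integrable.of_bound (by fun_prop) 1 (Eventually.of_forall fun z => ?_)
  rw [Real.norm_of_nonneg (Real.exp_nonneg _)]
  exact Real.exp_le_one_iff.2 (by nlinarith [mul_nonneg hs.le (hτ0 z)])

variable (μ τ) in
/-- The Laplace transform `t ↦ ∫ (1 + τ) exp (-τ t)`. -/
noncomputable def weightedLaplace : ℝ → ℝ :=
  mgf (fun z => -τ z) μ - deriv (mgf (fun z => -τ z) μ)

theorem analyticOnNhd_mgf_neg [IsFiniteMeasure μ] (hτ : Measurable τ) (hτ0 : ∀ z, 0 ≤ τ z) :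
    AnalyticOnNhd ℝ (mgf (fun z => -τ z) μ) (Ioi 0) :=
  fun _ ht => analyticAt_mgf (mem_interior_integrableExpSet_neg hτ hτ0 ht)

theorem iteratedDeriv_weightedLaplace [IsFiniteMeasure μ] (hτ : Measurable τ)
    (hτ0 : ∀ z, 0 ≤ τ z) (n : ℕ) {t : ℝ} (ht : 0 < t) :
    iteratedDeriv n (weightedLaplace μ τ) t =
      ∫ z, (-τ z) ^ n * ((1 + τ z) * Real.exp (-τ z * t)) ∂μ := by
  have hmem := mem_interior_integrableExpSet_neg (μ := μ) hτ hτ0 ht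
  have ha := analyticOnNhd_mgf_neg (μ := μ) hτ hτ0 t ht
  rw [weightedLaplace, iteratedDeriv_sub ha.contDiffAt ha.deriv.contDiffAt, ← iteratedDeriv_succ',
    iteratedDeriv_mgf hmem, iteratedDeriv_mgf hmem,
    ← integral_sub (integrable_pow_mul_exp_of_mem_interior_integrableExpSet hmem n)
      (integrable_pow_mul_exp_of_mem_interior_integrableExpSet hmem (n + 1))]
  refine integral_congr_ae (Eventually.of_forall fun z => ?_)
  simp only
  rw [mul_comm t]
  ring

theorem isCompletelyMonotonic_weightedLaplace [IsFiniteMeasure μ] (hτ : Measurable τ)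
    (hτ0 : ∀ z, 0 ≤ τ z) : IsCompletelyMonotonic (weightedLaplace μ τ) := by
  refine ⟨fun t ht => ?_, fun n t ht => ?_⟩
  · have ha := analyticOnNhd_mgf_neg (μ := μ) hτ hτ0 t ht
    exact (ha.contDiffAt.sub ha.deriv.contDiffAt).contDiffWithinAt
  · rw [iteratedDerivWithin_of_isOpen isOpen_Ioi ht, iteratedDeriv_weightedLaplace hτ hτ0 n ht,
      ← integral_const_mul]
    refine integral_nonneg fun z => ?_
    have h1 : (-1 : ℝ) ^ n * (-τ z) ^ n = τ z ^ n := by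
      rw [← mul_pow]
      ring
    simp only [Pi.zero_apply]
    rw [← mul_assoc, h1]
    have := hτ0 z
    positivity

variable (μ τ) in
/-- The mixture of the Bernstein functions `bernsteinKernel (τ z)` and a constant. -/
noncomputable def bernsteinMixture (c t : ℝ) : ℝ := c + ∫ z, bernsteinKernel (τ z) t ∂μ

theorem aestronglyMeasurable_bernsteinKernel (hτ : Measurable τ) (t : ℝ) :
    AEStronglyMeasurable (fun z => bernsteinKernel (τ z) t) μ :=
  (measurable_bernsteinKernel.comp (hτ.prodMk measurable_const)).aestronglyMeasurable

theorem integrable_bernsteinKernel [IsFiniteMeasure μ] (hτ : Measurable τ) (hτ0 : ∀ z, 0 ≤ τ z)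
    {t : ℝ} (ht : 0 ≤ t) : Integrable (fun z => bernsteinKernel (τ z) t) μ := by
  refine Integrable.of_bound (aestronglyMeasurable_bernsteinKernel hτ t) (1 + t)
    (Eventually.of_forall fun z => ?_)
  rw [Real.norm_of_nonneg (bernsteinKernel_nonneg (hτ0 z) ht)]
  exact bernsteinKernel_le (hτ0 z)

theorem hasDerivAt_bernsteinMixture [IsFiniteMeasure μ] (hτ : Measurable τ) (hτ0 : ∀ z, 0 ≤ τ z)
    (c : ℝ) {t : ℝ} (ht : 0 < t) :
    HasDerivAt (bernsteinMixture μ τ c) (weightedLaplace μ τ t) t := by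
  have hk : weightedLaplace μ τ t = ∫ z, (1 + τ z) * Real.exp (-τ z * t) ∂μ := by
    simpa using iteratedDeriv_weightedLaplace (μ := μ) hτ hτ0 0 ht
  rw [hk]
  refine HasDerivAt.const_add c ?_
  -- For `s > t / 2`, `(1 + τ) exp (-τ s) ≤ (1 + τ) / (1 + τ s) ≤ 1 + 2 / t`, uniformly in `τ`.
  refine (hasDerivAt_integral_of_dominated_loc_of_deriv_le (bound := fun _ => 1 + 2 / t)
    (s := Ioi (t / 2)) (Ioi_mem_nhds (by linarith))
    (F := fun t z => bernsteinKernel (τ z) t) (F' := fun t z => (1 + τ z) * Real.exp (-τ z * t))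
    (Eventually.of_forall fun s => aestronglyMeasurable_bernsteinKernel hτ s)
    (integrable_bernsteinKernel hτ hτ0 ht.le) (by fun_prop)
    (Eventually.of_forall fun z s hs => ?_) (integrable_const _)
    (Eventually.of_forall fun z s _ => hasDerivAt_bernsteinKernel (τ z) s)).2
  have hz := hτ0 z
  have hs : t / 2 < s := hs
  rw [Real.norm_of_nonneg (by positivity)]
  have h1 : Real.exp (-τ z * s) ≤ (1 + τ z * s)⁻¹ := by
    have hs0 : 0 < s := by linarith
    rw [neg_mul, Real.exp_neg]
    exact inv_anti₀ (by positivity) (by linarith [Real.add_one_le_exp (τ z * s)])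
  calc (1 + τ z) * Real.exp (-τ z * s) ≤ (1 + τ z) * (1 + τ z * s)⁻¹ :=
        mul_le_mul_of_nonneg_left h1 (by linarith)
    _ ≤ 1 + 2 / t := by
      have hs0 : 0 < s := by linarith
      have h2 : 1 ≤ 2 / t * s := by
        rw [div_mul_eq_mul_div, le_div_iff₀ ht]
        linarith
      have h3 : 0 ≤ 2 / t := by positivity
      have h4 : 0 ≤ τ z * s := by positivity
      rw [← div_eq_mul_inv, div_le_iff₀ (by positivity)]
      nlinarith [mul_le_mul_of_nonneg_left h2 hz]

theorem isBernstein_bernsteinMixture [IsFiniteMeasure μ] (hτ : Measurable τ) (hτ0 : ∀ z, 0 ≤ τ z)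
    {c : ℝ} (hc : 0 ≤ c) : IsBernstein (bernsteinMixture μ τ c) := by
  have hcont : ContinuousOn (bernsteinMixture μ τ c) (Ici 0) := by
    intro t ht
    rcases (mem_Ici.1 ht).eq_or_lt with rfl | ht
    · refine continuousWithinAt_const.add (continuousWithinAt_of_dominated (bound := fun _ => 2)
        (Eventually.of_forall fun s => aestronglyMeasurable_bernsteinKernel hτ s)
        ?_ (integrable_const _) (Eventually.of_forall fun z =>
          (hasDerivAt_bernsteinKernel (τ z) 0).continuousAt.continuousWithinAt))
      filter_upwards [self_mem_nhdsWithin, nhdsWithin_le_nhds (Iio_mem_nhds one_pos)] with s hs hs1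
      refine Eventually.of_forall fun z => ?_
      have hs1 : s < 1 := hs1
      rw [Real.norm_of_nonneg (bernsteinKernel_nonneg (hτ0 z) hs)]
      exact (bernsteinKernel_le (hτ0 z)).trans (by linarith)
    · exact (hasDerivAt_bernsteinMixture hτ hτ0 c ht).continuousAt.continuousWithinAt
  have hcm := isCompletelyMonotonic_weightedLaplace (μ := μ) hτ hτ0
  refine ⟨fun t ht => add_nonneg hc (integral_nonneg fun z => bernsteinKernel_nonneg (hτ0 z) ht),
    hcont, weightedLaplace μ τ, ⟨hcm, ?_⟩, fun t ht => hasDerivAt_bernsteinMixture hτ hτ0 c ht⟩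
  -- A non-negative derivative of a function continuous up to `0` is integrable there.
  exact intervalIntegral.integrableOn_deriv_of_nonneg (hcont.mono Icc_subset_Ici_self)
    (fun t ht => hasDerivAt_bernsteinMixture hτ hτ0 c ht.1)
    fun t ht => by simpa using hcm.2 0 t ht.1

/-- Fubini, with `exp (-x t) * (1 + t)` as integrable majorant on the product. -/
theorem sq_mul_laplaceTransform_bernsteinMixture [IsFiniteMeasure μ] (hτ : Measurable τ)
    (hτ0 : ∀ z, 0 ≤ τ z) (c : ℝ) {x : ℝ} (hx : 0 < x) :
    x ^ 2 * laplaceTransform (bernsteinMixture μ τ c) x =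
      c * x + ∫ z, (1 + τ z) * (x / (x + τ z)) ∂μ := by
  have hdom : Integrable (fun p : ℝ × Ω => Real.exp (-x * p.1) * (1 + 1 * p.1))
      ((volume.restrict (Ioi (0 : ℝ))).prod μ) :=
    (integrableOn_exp_mul_affine 1 1 hx).integrable.comp_fst μ
  have hint : Integrable (Function.uncurry fun t z => Real.exp (-x * t) * bernsteinKernel (τ z) t)
      ((volume.restrict (Ioi (0 : ℝ))).prod μ) := by
    refine hdom.mono' ?_ ?_
    · have hm : Measurable fun p : ℝ × Ω => bernsteinKernel (τ p.2) p.1 :=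
        measurable_bernsteinKernel.comp ((hτ.comp measurable_snd).prodMk measurable_fst)
      exact Measurable.aestronglyMeasurable
        (((measurable_const.mul measurable_fst).exp).mul hm)
    · have h1 : ∀ᵐ p ∂((volume.restrict (Ioi (0 : ℝ))).prod μ), p.1 ∈ Ioi (0 : ℝ) :=
        Measure.quasiMeasurePreserving_fst.ae (ae_restrict_mem measurableSet_Ioi)
      filter_upwards [h1] with p hp
      have hp : 0 < p.1 := hp
      rw [Function.uncurry, Real.norm_of_nonneg
        (mul_nonneg (Real.exp_nonneg _) (bernsteinKernel_nonneg (hτ0 _) hp.le)), one_mul]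
      exact mul_le_mul_of_nonneg_left (bernsteinKernel_le (hτ0 _)) (Real.exp_nonneg _)
  have hE : IntegrableOn (fun t => Real.exp (-x * t) * c) (Ioi 0) :=
    (integrableOn_exp_mul_Ioi (by linarith) 0).mul_const c
  have hR : IntegrableOn (fun t => ∫ z, Real.exp (-x * t) * bernsteinKernel (τ z) t ∂μ) (Ioi 0) :=
    hint.integral_prod_left
  have h1 : ∀ t, Real.exp (-x * t) * bernsteinMixture μ τ c t =
      Real.exp (-x * t) * c + ∫ z, Real.exp (-x * t) * bernsteinKernel (τ z) t ∂μ := by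
    intro t
    rw [integral_const_mul, bernsteinMixture, mul_add]
  have h2 : ∀ z, (1 + τ z) * (x / (x + τ z)) = x ^ 2 * ((1 + τ z) / (x * (x + τ z))) := by
    intro z
    have := hτ0 z
    field_simp
  rw [laplaceTransform]
  simp_rw [h1]
  rw [integral_add hE hR, integral_integral_swap hint, integral_mul_const,
    integral_exp_mul_Ioi (by linarith)]
  simp_rw [integral_exp_mul_bernsteinKernel (hτ0 _) hx, h2]
  rw [integral_const_mul]
  simp only [mul_zero, Real.exp_zero]
  field_simp

end Laplace

/-! ### Integral representation of the cone by compactness -/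

/-- The kernel `x / ((1 - s) x + s)` joining the functions `1` (`s = 0`) and `x` (`s = 1`). -/
noncomputable def compactKernel (x : Ioi (0 : ℝ)) : C(unitInterval, ℝ) where
  toFun s := x / ((1 - s) * x + s)
  continuous_toFun := by
    refine continuous_const.div (by fun_prop) fun s => ?_
    have hx : (0 : ℝ) < x := x.2
    have h0 := s.2.1
    have h1 := s.2.2
    rcases h0.eq_or_lt with h | h
    · rw [← h]
      simpa using hx.ne'
    · have : 0 ≤ (1 - (s : ℝ)) * x := mul_nonneg (by linarith) hx.le
      positivity

theorem continuous_integral_compactKernel : Continuous fun (ν : FiniteMeasure unitInterval)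
    (x : Ioi (0 : ℝ)) => ∫ s, compactKernel x s ∂(ν : Measure unitInterval) := by
  refine continuous_pi fun x => continuous_iff_continuousAt.2 fun ν => ?_
  exact FiniteMeasure.tendsto_iff_forall_integral_tendsto.1 tendsto_id
    (BoundedContinuousFunction.mkOfCompact (compactKernel x))

theorem integrable_compactKernel (x : Ioi (0 : ℝ)) (ν : FiniteMeasure unitInterval) :
    Integrable (compactKernel x) (ν : Measure unitInterval) :=
  (BoundedContinuousFunction.mkOfCompact (compactKernel x)).integrable _

/-- The kernel is normalised at `x = 1`, so the value of the function there controls the mass of its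
measure. -/
theorem integral_compactKernel_one (ν : FiniteMeasure unitInterval) :
    ∫ s, compactKernel ⟨1, mem_Ioi.2 one_pos⟩ s ∂(ν : Measure unitInterval) = ν.mass := by
  have : ∀ s, compactKernel ⟨1, mem_Ioi.2 one_pos⟩ s = 1 := fun s => by simp [compactKernel]
  simp_rw [this, integral_const, smul_eq_mul, mul_one]
  rfl

theorem exists_finiteMeasure_of_mem_span {F : Ioi (0 : ℝ) → ℝ}
    (hF : F ∈ Submodule.span ℝ≥0 (stieltjesAtom '' Ioi 0)) :
    ∃ ν : FiniteMeasure unitInterval, ∀ x, F x = ∫ s, compactKernel x s ∂(ν : Measure unitInterval)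
    := by
  induction hF using Submodule.span_induction with
  | mem G h =>
    obtain ⟨t, ht, rfl⟩ := h
    have ht : 0 < t := ht
    -- With `s = t / (1 + t)` the atom is `(1 + t)⁻¹` times the kernel at `s`.
    have hs : t / (1 + t) ∈ Icc (0 : ℝ) 1 :=
      ⟨by positivity, div_le_one_of_le₀ (by linarith) (by linarith)⟩
    obtain ⟨c, hc⟩ : ∃ c : ℝ≥0, (c : ℝ) = (1 + t)⁻¹ := ⟨⟨(1 + t)⁻¹, by positivity⟩, rfl⟩
    obtain ⟨d, hd⟩ : ∃ d : FiniteMeasure unitInterval, (d : Measure unitInterval) =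
      Measure.dirac ⟨t / (1 + t), hs⟩ :=
      ⟨⟨Measure.dirac _, inferInstance⟩, rfl⟩
    refine ⟨c • d, fun x => ?_⟩
    have hx : (0 : ℝ) < x := x.2
    rw [FiniteMeasure.toMeasure_smul, integral_smul_nnreal_measure]
    simp only [hd, integral_dirac, NNReal.smul_def, hc, smul_eq_mul]
    simp only [stieltjesAtom, compactKernel, ContinuousMap.coe_mk]
    have h1 : (1 - t / (1 + t)) * x + t / (1 + t) = (x + t) / (1 + t) := by
      field_simp
      ring
    rw [h1]
    field_simp
  | zero => exact ⟨0, fun x => by simp⟩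
  | add G H _ _ h1 h2 =>
    obtain ⟨ν₁, h1⟩ := h1
    obtain ⟨ν₂, h2⟩ := h2
    refine ⟨ν₁ + ν₂, fun x => ?_⟩
    rw [FiniteMeasure.toMeasure_add, integral_add_measure (integrable_compactKernel x ν₁)
      (integrable_compactKernel x ν₂), Pi.add_apply, h1, h2]
  | smul c G _ h =>
    obtain ⟨ν, h⟩ := h
    refine ⟨c • ν, fun x => ?_⟩
    rw [FiniteMeasure.toMeasure_smul, integral_smul_nnreal_measure, Pi.smul_apply, h]

/-- Integral representation of the elements of the cone. -/
theorem exists_finiteMeasure_of_mem_stieltjesCone {F : Ioi (0 : ℝ) → ℝ} (hF : F ∈ stieltjesCone) :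
    ∃ ν : FiniteMeasure unitInterval, ∀ x, F x = ∫ s, compactKernel x s ∂(ν : Measure unitInterval)
    := by
  set e : Ioi (0 : ℝ) := ⟨1, mem_Ioi.2 one_pos⟩ with he
  let C : ℝ≥0 := Real.toNNReal (F e + 1)
  have hopen : IsOpen {G : Ioi (0 : ℝ) → ℝ | G e < F e + 1} :=
    isOpen_lt (continuous_apply _) continuous_const
  have hmem : F ∈ closure ({G : Ioi (0 : ℝ) → ℝ | G e < F e + 1} ∩
      (Submodule.span ℝ≥0 (stieltjesAtom '' Ioi 0) : Set (Ioi (0 : ℝ) → ℝ))) :=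
    hopen.inter_closure ⟨lt_add_one (F e), hF⟩
  -- Measures of mass at most `C` on a compact space are weakly compact, so the functions they
  -- represent form a closed set, containing every finite combination with value at `1` below `F e +
  -- 1`.
  have hK := (isCompact_setOfPred_finiteMeasure_le_of_compactSpace unitInterval C).image
    continuous_integral_compactKernel
  have hsub : {G : Ioi (0 : ℝ) → ℝ | G e < F e + 1} ∩
      (Submodule.span ℝ≥0 (stieltjesAtom '' Ioi 0) : Set (Ioi (0 : ℝ) → ℝ)) ⊆
      (fun (ν : FiniteMeasure unitInterval) (x : Ioi (0 : ℝ)) =>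
        ∫ s, compactKernel x s ∂(ν : Measure unitInterval)) '' {ν | ν.mass ≤ C} := by
    intro G hG
    obtain ⟨ν, hν⟩ := exists_finiteMeasure_of_mem_span hG.2
    refine ⟨ν, ?_, funext fun x => (hν x).symm⟩
    have h1 : (ν.mass : ℝ) < F e + 1 := by
      rw [← integral_compactKernel_one, ← he, ← hν]
      exact hG.1
    exact NNReal.le_toNNReal_of_coe_le h1.le
  obtain ⟨ν, -, hν⟩ := closure_minimal hsub hK.isClosed hmem
  exact ⟨ν, fun x => by rw [← hν]⟩

/-- An element of the cone that extends continuously to `0` is a complete Bernstein function. -/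
theorem isCompleteBernstein_of_mem_stieltjesCone {f : ℝ → ℝ}
    (hf : (fun x : Ioi (0 : ℝ) => f x) ∈ stieltjesCone) (hf0 : ContinuousWithinAt f (Ici 0) 0) :
    IsCompleteBernstein f := by
  obtain ⟨ν, hν⟩ := exists_finiteMeasure_of_mem_stieltjesCone hf
  -- At `s = 1` the kernel is `x`, corresponding to `τ = ∞`; its mass becomes the constant term of
  -- the mixture. For `s < 1` the kernel is `(1 + τ) * (x / (x + τ))`.
  let S : Set unitInterval := {1}
  have hS : MeasurableSet S := measurableSet_singleton 1
  let τ : unitInterval → ℝ := fun s => s / (1 - s)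
  have hτ : Measurable τ := by fun_prop
  have hτ0 : ∀ s, 0 ≤ τ s := fun s => div_nonneg s.2.1 (by linarith [s.2.2])
  refine ⟨hf0, bernsteinMixture ((ν : Measure unitInterval).restrict Sᶜ) τ
    ((ν : Measure unitInterval).real S), isBernstein_bernsteinMixture hτ hτ0 measureReal_nonneg,
    fun x hx => ?_⟩
  have hx0 : 0 < x := hx
  rw [sq_mul_laplaceTransform_bernsteinMixture hτ hτ0 _ hx0, hν ⟨x, hx⟩,
    ← integral_add_compl hS (integrable_compactKernel _ ν)]
  congr 1
  · rw [integral_singleton]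
    simp [compactKernel, S]
  · refine setIntegral_congr_fun hS.compl fun s hs => ?_
    have hs1 : (s : ℝ) ≠ 1 := fun h => hs (Subtype.ext h)
    have hs2 : 0 < 1 - (s : ℝ) := by
      have := lt_of_le_of_ne s.2.2 hs1
      linarith
    have hs0 := s.2.1
    have h3 : 0 < (1 - (s : ℝ)) * x := mul_pos hs2 hx0
    have h1 : 1 + τ s = 1 / (1 - s) := by
      simp only [τ]
      field_simp
      ring
    have h2 : x + τ s = ((1 - s) * x + s) / (1 - s) := by
      simp only [τ]
      field_simp
    simp only [h1, h2, compactKernel, ContinuousMap.coe_mk]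
    field_simp

/-! ### Degenerate cases and conclusion -/

theorem isCompleteBernstein_zero_of_eqOn {f : ℝ → ℝ} (hf : ∀ x, 0 ≤ x → f x = 0) :
    IsCompleteBernstein f := by
  refine isCompleteBernstein_of_mem_stieltjesCone ?_ ?_
  · convert! stieltjesCone.zero_mem using 1
    ext x
    exact hf x (le_of_lt x.2)
  · exact (continuousWithinAt_const (b := (0 : ℝ))).congr (fun x hx => hf x hx) (hf 0 le_rfl)

theorem IsCompleteBernstein.eq_zero_of_nonpos {f : ℝ → ℝ} (hf : IsCompleteBernstein f)
    (h1 : f 1 ≤ 0) {x : ℝ} (hx : 0 ≤ x) : f x = 0 := by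
  have hpos : ∀ y, 0 < y → f y = 0 := by
    intro y hy
    -- At `x = 2` the bounds read `f 1 ≤ f 2 ≤ 2 * f 1`, forcing `f 1 ≥ 0`.
    have hb2 := bounds_of_mem_stieltjesCone hf.mem_stieltjesCone ⟨2, mem_Ioi.2 two_pos⟩
    have hb := bounds_of_mem_stieltjesCone hf.mem_stieltjesCone ⟨y, hy⟩
    have h3 : f 1 = 0 := by
      norm_num at hb2
      linarith [hb2.1, hb2.2]
    simp only [h3, mul_zero] at hb
    exact le_antisymm hb.2 hb.1
  rcases hx.eq_or_lt with rfl | hx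
  · have h2 : Tendsto f (𝓝[>] 0) (𝓝 (f 0)) := hf.1.mono_left (nhdsWithin_mono 0 Ioi_subset_Ici_self)
    refine tendsto_nhds_unique h2 (tendsto_const_nhds.congr' ?_)
    filter_upwards [self_mem_nhdsWithin] with y hy using (hpos y hy).symm
  · exact hpos x hx

theorem mainTheorem7 (f g : ℝ → ℝ) (hf : IsCompleteBernstein f) (hg : IsCompleteBernstein g)
    (α : ℝ) (hα0 : 0 ≤ α) (hα1 : α ≤ 1) :
    IsCompleteBernstein (fun x => f x ^ α * g x ^ (1 - α)) := by
  rcases hα0.eq_or_lt with rfl | hα0'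
  -- The endpoints are settled first: here `0 ^ 0 = 1` matters, whereas below both exponents are
  -- positive and a vanishing factor makes the product vanish.
  · simpa using hg
  rcases hα1.eq_or_lt with rfl | hα1'
  · simpa using hf
  rcases le_or_gt (f 1) 0 with hf1 | hf1
  · refine isCompleteBernstein_zero_of_eqOn fun x hx => ?_
    rw [hf.eq_zero_of_nonpos hf1 hx, Real.zero_rpow hα0'.ne', zero_mul]
  rcases le_or_gt (g 1) 0 with hg1 | hg1
  · refine isCompleteBernstein_zero_of_eqOn fun x hx => ?_
    rw [hg.eq_zero_of_nonpos hg1 hx, Real.zero_rpow (by linarith), mul_zero]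
  refine isCompleteBernstein_of_mem_stieltjesCone
    (rpow_mul_rpow_mem_stieltjesCone hf.mem_stieltjesCone hg.mem_stieltjesCone hf1 hg1
      ⟨hα0, hα1⟩) ?_
  -- Non-negative exponents give continuity at `0` even when `f 0` or `g 0` vanishes.
  exact (hf.1.rpow_const (Or.inr hα0)).mul (hg.1.rpow_const (Or.inr (by linarith)))
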